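/- For an oriented link diagram $D$ and a commutative ring $\mathbb{K}$, let $C_{\mathrm{BN}}^\ast(D;\mathbb{K})$ be the Bar-Natan complex, that is, the complex obtained from the cube of resolutions of $D$ by means of the Frobenius algebra $A=\mathbb{K}[x]/(x^2-x)$ with $\Delta(1)=1\otimes x+x\otimes 1-1\otimes 1$, $\Delta(x)=x\otimes x$, with cochain groups graded as in Khovanov homology ($1$ has quantum degree $1$ and $x$ has quantum degree $-1$; positive knots have non-negative $s$-invariant). Let $\mathcal{F}_q$ be the subcomplex spanned by the standard generators of quantum degree at least $q$. For a basepoint on $D$ let $\tilde{C}_{\mathrm{BN}}^\ast(D;\mathbb{K})=x\,C_{\mathrm{BN}}^\ast(D;\mathbb{K})$ be the reduced complex, where $x$ acts on the tensor factor of the circle through the basepoint, with the filtration $\tilde{\mathcal{F}}_{q}=x\mathcal{F}_{q+1}$. Write $H_{\mathrm{BN}}^\ast$ and $\tilde{H}_{\mathrm{BN}}^\ast$ for the cohomology groups. The induced filtrations are $$H_{\mathrm{BN}}^0(D;\mathbb{K})_q=\operatorname{im}\bigl(H^0(\mathcal{F}_q)\to H_{\mathrm{BN}}^0(D;\mathbb{K})\bigr),\qquad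 \tilde{H}_{\mathrm{BN}}^0(D;\mathbb{K})_q=\operatorname{im}\bigl(H^0(\tilde{\mathcal{F}}_q)\to \tilde{H}_{\mathrm{BN}}^0(D;\mathbb{K})\bigr),$$ and $\tilde{H}_{\mathrm{BN}}^0(D;\mathbb{K})^{(q)}=\tilde{H}_{\mathrm{BN}}^0(D;\mathbb{K})_q/\tilde{H}_{\mathrm{BN}}^0(D;\mathbb{K})_{q+2}$. Let $K$ be a knot, given by any oriented diagram $D$ with any basepoint. For a field $\mathbb{F}$ the Rasmussen invariant is $$s^{\mathbb{F}}(K)=\max\{q\in 2\mathbb{Z}+1\mid H_{\mathrm{BN}}^0(D;\mathbb{F})_q\neq 0\}-1,$$ and the graded length $\mathrm{gl}(K)$ is the largest integer $l$ such that $\tilde{H}_{\mathrm{BN}}^0(D;\mathbb{Z})^{(s^{\mathbb{Q}}(K)-2l)}\neq 0$. Then, for every prime $p$, the maxima that define $s^{\mathbb{Q}}(K)$, $s^{\mathbb{F}_p}(K)$ and $\mathrm{gl}(K)$ exist, and $$\mathrm{gl}(K)\;\geq\;\frac{s^{\mathbb{Q}}(K)-s^{\mathbb{F}_p}(K)}{2}.$$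 -/

import Mathlib

noncomputable section

/-! ## Cohomology of a filtered cochain complex -/

namespace FilteredCohomology

variable {R M : Type*} [CommRing R] [AddCommGroup M] [Module R M]

/-- The degree `i` cocycles of the (sub)complex with cochain groups `C i`, all of them submodules
of one module `M` that carries the total differential `d`. -/
def cocycles (d : M →ₗ[R] M) (C : ℤ → Submodule R M) (i : ℤ) : Submodule R M :=
  C i ⊓ LinearMap.ker d

/-- The degree `i` coboundaries. -/
def coboundaries (d : M →ₗ[R] M) (C : ℤ → Submodule R M) (i : ℤ) : Submodule R M :=
  (C (i - 1)).map d

/-- The cohomology group `H^i(C)`, cocycles modulo coboundaries. -/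
abbrev Cohomology (d : M →ₗ[R] M) (C : ℤ → Submodule R M) (i : ℤ) : Type _ :=
  cocycles d C i ⧸ (coboundaries d C i).submoduleOf (cocycles d C i)

/-- The map `H^i(C') → H^i(C)` induced by the inclusion of a subcomplex `C'` of `C`. -/
def inclusionMap (d : M →ₗ[R] M) {C' C : ℤ → Submodule R M} (h : ∀ i, C' i ≤ C i) (i : ℤ) :
    Cohomology d C' i →ₗ[R] Cohomology d C i :=
  Submodule.mapQ _ _ (Submodule.inclusion (inf_le_inf_right _ (h i))) (by
    intro z hz
    obtain ⟨y, hy, hyz⟩ := hz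
    exact ⟨y, h _ hy, hyz⟩)

/-- The induced filtration `H^i(C)_q = im (H^i(F_q) → H^i(C))`. -/
def inducedFiltration (d : M →ₗ[R] M) (C : ℤ → Submodule R M) (F : ℤ → ℤ → Submodule R M)
    (hF : ∀ q i, F q i ≤ C i) (i q : ℤ) : Submodule R (Cohomology d C i) :=
  LinearMap.range (inclusionMap d (hF q) i)

/-- The associated graded group `H^i(C)^{(q)} = H^i(C)_q / H^i(C)_{q+2}`. -/
abbrev AssociatedGraded (d : M →ₗ[R] M) (C : ℤ → Submodule R M) (F : ℤ → ℤ → Submodule R M)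
    (hF : ∀ q i, F q i ≤ C i) (i q : ℤ) : Type _ :=
  inducedFiltration d C F hF i q ⧸
    (inducedFiltration d C F hF i (q + 2)).submoduleOf (inducedFiltration d C F hF i q)

end FilteredCohomology

/-! ## Knot diagrams -/

/-- A planar diagram code with `n` crossings and `m` oriented edges. At each crossing `c` the four
slots are numbered counterclockwise, beginning with the incoming end of the under-strand, and
`edge c j` is the edge at slot `j`. So the under-strand runs from slot `0` to slot `2`. The
over-strand runs from slot `3` to slot `1` if `c` is a positive crossing, and from slot `1` to
slot `3` if `c` is a negative crossing. An edge that meets no crossing is a closed circle. -/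
structure PDCode where
  n : ℕ
  m : ℕ
  edge : Fin n → Fin 4 → Fin m
  positive : Fin n → Bool

namespace PDCode

variable (D : PDCode)

/-- The edge by which the over-strand (`true`) or the under-strand (`false`) enters a crossing. -/
def inEdge (s : Fin D.n × Bool) : Fin D.m :=
  if s.2 then (if D.positive s.1 then D.edge s.1 3 else D.edge s.1 1) else D.edge s.1 0

/-- The edge by which the over-strand (`true`) or the under-strand (`false`) leaves a crossing. -/
def outEdge (s : Fin D.n × Bool) : Fin D.m :=
  if s.2 then (if D.positive s.1 then D.edge s.1 1 else D.edge s.1 3) else D.edge s.1 2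

/-- Whether the edge at slot `j` of the crossing `c` is oriented away from `c` there. -/
def isOut (c : Fin D.n) (j : Fin 4) : Bool :=
  if j = 0 then false
  else if j = 2 then true
  else if j = 1 then D.positive c
  else !(D.positive c)

/-- Each edge `e` has two sides, `(e, true)` on its left and `(e, false)` on its right. This is the
side of the edge at slot `j` that lies on the left when one looks from `c` along the edge. -/
def leftSide (c : Fin D.n) (j : Fin 4) : Fin D.m × Bool := (D.edge c j, D.isOut c j)

/-- The side of the edge at slot `j` on the right when one looks from `c` along the edge. -/
def rightSide (c : Fin D.n) (j : Fin 4) : Fin D.m × Bool := (D.edge c j, !(D.isOut c j))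

/-- Two sides of edges bound the same face; generated by the corners at the crossings, the corner
between slots `j` and `j + 1` (modulo `4`) being left of the former and right of the latter. -/
def faceSetoid : Setoid (Fin D.m × Bool) :=
  Relation.EqvGen.setoid fun s t => ∃ c j, s = D.leftSide c j ∧ t = D.rightSide c (j + 1)

end PDCode

/-- An oriented knot diagram on the sphere. -/
structure KnotDiagram extends PDCode where
  /-- There is at least one edge. -/
  m_pos : 0 < m
  /-- No edge enters two crossings. -/
  in_injective : Function.Injective toPDCode.inEdge
  /-- No edge leaves two crossings. -/
  out_injective : Function.Injective toPDCode.outEdge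
  /-- The edges that enter a crossing are those that leave one. -/
  range_eq : Set.range toPDCode.inEdge = Set.range toPDCode.outEdge
  /-- There is one component: all edges are connected by going straight through crossings. -/
  single_component : ∀ e f : Fin m,
    Relation.EqvGen (fun e f => ∃ s, e = toPDCode.inEdge s ∧ f = toPDCode.outEdge s) e f
  /-- Planarity, by Euler's formula: `n` crossings and `2 * n` edges (for `0 < n`) leave `n + 2`
  faces. The circle without crossings has two faces as well. -/
  planar : Nat.card (Quotient toPDCode.faceSetoid) = n + 2

/-! ## The Bar-Natan complex -/

/-- The coefficient of `x ^ c` in the product `x ^ a * x ^ b` in `A = K[x]/(x ^ 2 - x)`, where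
`a, b, c` are `0` or `1`. -/
def mulCoeff (a b c : Fin 2) : ℤ := if c = max a b then 1 else 0

/-- The coefficient of `x ^ b ⊗ x ^ c` in `Δ (x ^ a)`, where `Δ 1 = 1 ⊗ x + x ⊗ 1 - 1 ⊗ 1` and
`Δ x = x ⊗ x`. -/
def comulCoeff : Fin 2 → Fin 2 → Fin 2 → ℤ
  | 0, 0, 0 => -1
  | 0, 0, 1 => 1
  | 0, 1, 0 => 1
  | 0, 1, 1 => 0
  | 1, 1, 1 => 1
  | 1, _, _ => 0

namespace PDCode

variable (D : PDCode)

/-- A vertex of the cube of resolutions: `false` is the `0`-smoothing and `true` the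
`1`-smoothing of a crossing. -/
abbrev Vertex : Type := Fin D.n → Bool

/-- The circles of the smoothing `v`, as an equivalence relation on the edges. The `0`-smoothing
joins slots `0, 1` and slots `2, 3`; the `1`-smoothing joins slots `1, 2` and slots `3, 0`. -/
def circleSetoid (v : D.Vertex) : Setoid (Fin D.m) :=
  Relation.EqvGen.setoid fun e f => ∃ c,
    (v c = false ∧ ((e = D.edge c 0 ∧ f = D.edge c 1) ∨ (e = D.edge c 2 ∧ f = D.edge c 3))) ∨
    (v c = true ∧ ((e = D.edge c 1 ∧ f = D.edge c 2) ∨ (e = D.edge c 3 ∧ f = D.edge c 0)))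

/-- The set of circles of the smoothing `v`. -/
abbrev Circle (v : D.Vertex) : Type := Quotient (D.circleSetoid v)

/-- The circle that contains the edge `e`. -/
def circle (v : D.Vertex) (e : Fin D.m) : D.Circle v := Quotient.mk (D.circleSetoid v) e

instance (v : D.Vertex) : Fintype (D.Circle v) := Fintype.ofFinite _

/-- The standard generators: `⟨v, l⟩` is the tensor product of the `x ^ (l C)` over the circles `C`
of `v`, so these with fixed `v` are the standard basis of the tensor power of `A`. -/
abbrev Generator : Type := Σ v : D.Vertex, (D.Circle v → Fin 2)

instance : Fintype D.Generator := by
  classical exact inferInstance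

/-- The exponent of `x` that a generator has on the circle through `e`. -/
def label (σ : D.Generator) (e : Fin D.m) : Fin 2 := σ.2 (D.circle σ.1 e)

/-- The number of `1`-smoothings. -/
def height (v : D.Vertex) : ℕ := (Finset.univ.filter fun c => v c = true).card

/-- The number of positive crossings. -/
def nPlus : ℕ := (Finset.univ.filter fun c => D.positive c = true).card

/-- The number of negative crossings. -/
def nMinus : ℕ := (Finset.univ.filter fun c => D.positive c = false).card

/-- The homological degree of a generator. -/
def homDegree (σ : D.Generator) : ℤ := (D.height σ.1 : ℤ) - D.nMinus

/-- The quantum degree of a generator; `1` has degree `1` and `x` has degree `-1`. -/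
def qDegree (σ : D.Generator) : ℤ :=
  (∑ C : D.Circle σ.1, (1 - 2 * ((σ.2 C : ℕ) : ℤ))) + D.height σ.1 + D.nPlus - 2 * D.nMinus

open Classical in
/-- The coefficient of `τ` in the image of `σ` under the edge of the cube that changes the crossing
`c` from its `0`-smoothing to its `1`-smoothing. If slots `0` and `2` of `c` lie on one circle
of `σ.1`, this circle is split by the comultiplication; otherwise the two circles there are merged
by the multiplication. The other circles keep their labels. -/
def edgeCoeff (c : Fin D.n) (σ τ : D.Generator) : ℤ :=
  if σ.1 c = false ∧ τ.1 = Function.update σ.1 c true ∧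
      ∀ e, D.circle σ.1 e ≠ D.circle σ.1 (D.edge c 0) →
        D.circle σ.1 e ≠ D.circle σ.1 (D.edge c 2) → D.label τ e = D.label σ e then
    if D.circle σ.1 (D.edge c 0) = D.circle σ.1 (D.edge c 2) then
      comulCoeff (D.label σ (D.edge c 0)) (D.label τ (D.edge c 0)) (D.label τ (D.edge c 2))
    else
      mulCoeff (D.label σ (D.edge c 0)) (D.label σ (D.edge c 2)) (D.label τ (D.edge c 0))
  else 0

/-- The usual sign of the edge of the cube at the vertex `v` in direction `c`. -/
def edgeSign (v : D.Vertex) (c : Fin D.n) : ℤ :=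
  (-1) ^ (Finset.univ.filter fun c' => c' < c ∧ v c' = true).card

variable (K : Type*) [CommRing K]

/-- The total Bar-Natan cochain module, free on the standard generators. -/
abbrev Cochains : Type _ := D.Generator → K

/-- The Bar-Natan differential. -/
def differential : D.Cochains K →ₗ[K] D.Cochains K :=
  Matrix.mulVecLin (Matrix.of fun τ σ =>
    ((∑ c, D.edgeSign σ.1 c * D.edgeCoeff c σ τ : ℤ) : K))

/-- The span of the standard generators with the property `P`. -/
def spanOf (P : D.Generator → Prop) : Submodule K (D.Cochains K) where
  carrier := {f | ∀ σ, ¬ P σ → f σ = 0}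
  add_mem' := fun ha hb σ hσ => by simp [ha σ hσ, hb σ hσ]
  zero_mem' := fun _ _ => rfl
  smul_mem' := fun r f hf σ hσ => by simp [hf σ hσ]

/-- The cochain group of the Bar-Natan complex in homological degree `i`. -/
def bnComplex (i : ℤ) : Submodule K (D.Cochains K) :=
  D.spanOf K fun σ => D.homDegree σ = i

/-- The subcomplex `F_q`, spanned by the generators of quantum degree at least `q`. -/
def bnFiltration (q i : ℤ) : Submodule K (D.Cochains K) :=
  D.spanOf K fun σ => D.homDegree σ = i ∧ q ≤ D.qDegree σ

theorem bnFiltration_le (q i : ℤ) : D.bnFiltration K q i ≤ D.bnComplex K i :=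
  fun _ hf σ hσ => hf σ fun h => hσ h.1

open Classical in
/-- The action of `x` at the basepoint on the edge `b`: multiply by `x` the tensor factor of the
circle through `b`. On generators, `x * 1 = x` and `x * x = x`. -/
def xAction (b : Fin D.m) : D.Cochains K →ₗ[K] D.Cochains K :=
  Matrix.mulVecLin (Matrix.of fun τ σ : D.Generator =>
    if τ = ⟨σ.1, Function.update σ.2 (D.circle σ.1 b) 1⟩ then (1 : K) else 0)

/-- The reduced Bar-Natan complex, the image of the action of `x`. -/
def reducedComplex (b : Fin D.m) (i : ℤ) : Submodule K (D.Cochains K) :=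
  (D.bnComplex K i).map (D.xAction K b)

/-- The filtration of the reduced complex: the term of index `q` is `x F_{q+1}`. -/
def reducedFiltration (b : Fin D.m) (q i : ℤ) : Submodule K (D.Cochains K) :=
  (D.bnFiltration K (q + 1) i).map (D.xAction K b)

theorem reducedFiltration_le (b : Fin D.m) (q i : ℤ) :
    D.reducedFiltration K b q i ≤ D.reducedComplex K b i :=
  Submodule.map_mono (D.bnFiltration_le K (q + 1) i)

end PDCode

/-! ## The Rasmussen invariants and the graded length -/

namespace KnotDiagram

variable (D : KnotDiagram)

/-- The odd `q` for which the step `H_BN^0(D; K)_q` of the induced filtration is not zero. -/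
def sMaxSet (K : Type*) [CommRing K] : Set ℤ :=
  {q | Odd q ∧ FilteredCohomology.inducedFiltration (D.differential K) (D.bnComplex K)
    (D.bnFiltration K) (D.bnFiltration_le K) 0 q ≠ ⊥}

/-- The largest such `q`. -/
def sMax (K : Type*) [CommRing K] : ℤ := sSup (D.sMaxSet K)

/-- The Rasmussen invariant over the field `K`. -/
def sInvariant (K : Type*) [Field K] : ℤ := D.sMax K - 1

/-- The integers `l` for which the associated graded group of the reduced integral Bar-Natan
cohomology in homological degree `0` and filtration index `s^ℚ - 2 * l` is not zero. -/
def gradedLengthSet (b : Fin D.m) : Set ℤ :=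
  {l | Nontrivial (FilteredCohomology.AssociatedGraded (D.differential ℤ) (D.reducedComplex ℤ b)
    (D.reducedFiltration ℤ b) (D.reducedFiltration_le ℤ b) 0 (D.sInvariant ℚ - 2 * l))}

/-- The graded length, the largest such `l`. -/
def gradedLength (b : Fin D.m) : ℤ := sSup (D.gradedLengthSet b)

end KnotDiagram

end

/-! Write `q = s^ℚ - 2 gl`. Below `q` the induced filtration of the reduced integral `H^0` has no
jumps in the relevant parity, and it is exhaustive, so all of the reduced `H^0` lies in level `q`
(`gradedLength_spec`). Apply this to the cocycle of the oriented resolution that puts the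
idempotents `x` and `1 - x` on the Seifert circles, with `x` at the basepoint: it is cohomologous
over `ℤ` to a cocycle `z` in `x F_{q+1}`, whose quantum degrees are at least `q - 1`. Let `f` be the
reduction of `z` modulo `p`.

The involution `x ↦ 1 - x`, corrected by signs, is a chain map, and on the part of `f` in the lowest
degree `q - 1` its leading term is one common sign. Hence `f` minus or plus its conjugate is a
cocycle in `F_{q+1}` (`sub_conjugation_mem`). It is not a coboundary: the coordinate at the Seifert
idempotent vanishes on coboundaries, is `1` on `f`, and is `0` on the conjugate, which carries `1 -
x` at the basepoint. So `s^{F_p} + 1 ≥ q + 1` (`add_one_mem_sMaxSet`), which is the inequality. Of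
`s^ℚ` only the parity matters.

The computations use that `A` is `K × K` as an algebra: a cochain at a vertex is a function on the
2-colourings of its circles (`evalAt`), and every edge map of the cube becomes diagonal
(`evalAt_differential`). This needs each edge of the cube to be a split or a merge, which follows
from the parity of the number of circles. The parity comes from signs of permutations whose orbits
are the circles, and these permutations come from a checkerboard colouring, the one place where
planarity enters. -/

noncomputable section

/-! ## Orbits of permutations and joins of equivalence relations -/

namespace Equiv.Perm

/-- The sign of a permutation in terms of its number of orbits. -/
theorem sign_eq_neg_one_pow_card_add_card_orbits {α : Type*} [Fintype α]
    [DecidableEq α] (f : Equiv.Perm α) :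
    sign f = (-1) ^ (Fintype.card α + Nat.card (Quotient (SameCycle.setoid f))) := by
  classical
  -- `cycleFactorsFinset` omits the fixed points, so these are tagged separately; the fibres of `g`
  -- are then exactly the orbits.
  let g : α → Equiv.Perm α ⊕ α := fun x => if f x = x then Sum.inr x else Sum.inl (cycleOf f x)
  have hg : ∀ x y, g x = g y ↔ SameCycle f x y := by
    intro x y
    by_cases hx : f x = x
    · by_cases hy : f y = y
      · simp only [g, hx, hy, if_true, Sum.inr.injEq]
        exact ⟨fun h => h ▸ SameCycle.refl _ _, fun h => h.eq_of_left hx⟩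
      · simp only [g, hx, hy, if_true, if_false, reduceCtorEq, false_iff]
        intro h
        exact hy (h.apply_eq_self_iff.1 hx)
    · by_cases hy : f y = y
      · simp only [g, hx, hy, if_true, if_false, reduceCtorEq, false_iff]
        intro h
        exact hx (h.apply_eq_self_iff.2 hy)
      · simp only [g, hx, hy, if_false, Sum.inl.injEq]
        exact (sameCycle_iff_cycleOf_eq_of_mem_support (mem_support.2 hx) (mem_support.2 hy)).symm
  have himg : Finset.univ.image g
      = f.cycleFactorsFinset.disjSum (Finset.univ.filter fun x => f x = x) := by
    ext z
    rcases z with c | y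
    · simp only [Finset.mem_image, Finset.mem_univ, true_and, Finset.inl_mem_disjSum]
      constructor
      · rintro ⟨x, hx⟩
        by_cases h : f x = x
        · simp [g, h] at hx
        · simp only [g, h, if_false, Sum.inl.injEq] at hx
          rw [← hx, cycleOf_mem_cycleFactorsFinset_iff]
          exact mem_support.2 h
      · intro hc
        obtain ⟨x, hx⟩ := (mem_cycleFactorsFinset_iff.1 hc).1.nonempty_support
        have hx' := mem_cycleFactorsFinset_support_le hc hx
        refine ⟨x, ?_⟩
        simp only [g, mem_support.1 hx', if_false, Sum.inl.injEq]
        exact (cycle_is_cycleOf hx hc).symm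
    · simp only [Finset.mem_image, Finset.mem_univ, true_and, Finset.inr_mem_disjSum,
        Finset.mem_filter]
      constructor
      · rintro ⟨x, hx⟩
        by_cases h : f x = x
        · simp only [g, h, if_true, Sum.inr.injEq] at hx
          exact hx ▸ h
        · simp [g, h] at hx
      · intro h
        exact ⟨y, by simp [g, h]⟩
  have hcard : Nat.card (Quotient (SameCycle.setoid f))
      = f.cycleFactorsFinset.card + (Finset.univ.filter fun x => f x = x).card := by
    rw [← Finset.card_disjSum, ← himg]
    have e : Quotient (SameCycle.setoid f) ≃ Set.range g :=
      (Quotient.congrRight fun x y => (hg x y).symm).trans (Setoid.quotientKerEquivRange g)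
    rw [Nat.card_congr e, Nat.card_eq_fintype_card, ← Set.toFinset_card, Set.toFinset_range]
  have hfix : (Finset.univ.filter fun x => f x = x).card + f.support.card = Fintype.card α := by
    rw [← Finset.card_univ, ← Finset.card_filter_add_card_filter_not (s := Finset.univ)
      (fun x => f x = x)]
    rfl
  have htype : f.cycleType.card = f.cycleFactorsFinset.card := by
    simp [cycleType_def]
  rw [sign_of_cycleType, sum_cycleType, htype, hcard, ← hfix]
  rw [show (Finset.univ.filter fun x => f x = x).card + f.support.card
      + (f.cycleFactorsFinset.card + (Finset.univ.filter fun x => f x = x).card)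
      = (f.support.card + f.cycleFactorsFinset.card)
        + 2 * (Finset.univ.filter fun x => f x = x).card by ring, pow_add _ _ (2 * _), pow_mul]
  simp

end Equiv.Perm

namespace Setoid

variable {α : Type*}

open Classical in
/-- The equivalence relation obtained from `r` by joining the classes of `x` and `y`. -/
def joinPair (r : Setoid α) (x y : α) : Setoid α :=
  Setoid.ker fun a => if r a y then (Quotient.mk r x) else Quotient.mk r a

theorem le_joinPair (r : Setoid α) (x y : α) : r ≤ r.joinPair x y := by
  classical
  intro a b h
  have h1 : r a y ↔ r b y := ⟨fun h' => r.trans' (r.symm' h) h', fun h' => r.trans' h h'⟩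
  show ite _ _ _ = ite _ _ _
  simp only [h1]
  split_ifs
  · rfl
  · exact Quotient.sound h

theorem joinPair_pair (r : Setoid α) (x y : α) : r.joinPair x y x y := by
  classical
  show ite _ _ _ = ite _ _ _
  rw [if_pos (r.refl' y)]
  split_ifs <;> rfl

theorem joinPair_le {r s : Setoid α} {x y : α} (h : r ≤ s) (hxy : s x y) :
    r.joinPair x y ≤ s := by
  classical
  intro a b hab
  have hab' : ite (r a y) (Quotient.mk r x) (Quotient.mk r a)
    = ite (r b y) (Quotient.mk r x) (Quotient.mk r b) := hab
  split_ifs at hab' with h1 h2 h2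
  · exact h (r.trans' h1 (r.symm' h2))
  · exact s.trans' (h h1) (s.trans' (s.symm' hxy) (h (Quotient.exact hab')))
  · exact s.trans' (h (Quotient.exact hab')) (s.trans' hxy (s.symm' (h h2)))
  · exact h (Quotient.exact hab')

theorem joinPair_eq_self {r : Setoid α} {x y : α} (h : r x y) : r.joinPair x y = r :=
  le_antisymm (joinPair_le le_rfl h) (le_joinPair r x y)

theorem joinPair_rel_of_not {r : Setoid α} {x y a : α} {b : α} (h : r.joinPair x y a b)
    (hx : ¬ r a x) (hy : ¬ r a y) : r a b := by
  classical
  have hab' : ite (r a y) (Quotient.mk r x) (Quotient.mk r a)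
    = ite (r b y) (Quotient.mk r x) (Quotient.mk r b) := h
  rw [if_neg hy] at hab'
  split_ifs at hab' with h2
  · exact absurd (Quotient.exact hab') hx
  · exact Quotient.exact hab'

theorem card_quotient_joinPair [Finite α] {r : Setoid α} {x y : α} (h : ¬ r x y) :
    Nat.card (Quotient r) = Nat.card (Quotient (r.joinPair x y)) + 1 := by
  classical
  have e := Setoid.quotientKerEquivRange
    (fun a => if r a y then (Quotient.mk r x) else Quotient.mk r a)
  have h2 : Nat.card (Quotient (r.joinPair x y)) = Nat.card _ := Nat.card_congr e
  rw [h2]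
  -- The class of `y` is redirected to that of `x`, and it is the only value missed.
  have h3 : Set.range (fun a => if r a y then (Quotient.mk r x) else Quotient.mk r a)
      = {Quotient.mk r y}ᶜ := by
    ext q
    simp only [Set.mem_range, Set.mem_compl_iff, Set.mem_singleton_iff]
    constructor
    · rintro ⟨a, rfl⟩
      split_ifs with ha
      · exact fun h' => h (Quotient.exact h')
      · exact fun h' => ha (Quotient.exact h')
    · induction q using Quotient.inductionOn with
      | h a =>
        intro ha
        exact ⟨a, if_neg fun h' => ha (Quotient.sound h')⟩
  have : Fintype (Quotient r) := Fintype.ofFinite _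
  rw [h3, Nat.card_coe_set_eq, Set.ncard_compl, Set.ncard_singleton]
  have : 0 < Nat.card (Quotient r) := by
    have : Nonempty (Quotient r) := ⟨Quotient.mk r x⟩
    exact Nat.card_pos
  omega

/-- If joining the classes of `x` and `y` makes `r` and `s` equal, and the numbers of classes of
`r` and `s` differ in parity, then `x` and `y` are related by exactly one of `r` and `s`. -/
theorem rel_iff_not_rel_of_joinPair_eq [Finite α] {r s : Setoid α} {x y : α}
    (h : r.joinPair x y = s.joinPair x y)
    (hodd : Odd (Nat.card (Quotient r) + Nat.card (Quotient s))) : r x y ↔ ¬ s x y := by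
  by_cases hr : r x y <;> by_cases hs : s x y
  · rw [joinPair_eq_self hr, joinPair_eq_self hs] at h
    rw [h] at hodd
    exact absurd hodd (by simp)
  · simp [hr, hs]
  · simp [hr, hs]
  · rw [card_quotient_joinPair hr, card_quotient_joinPair hs, h] at hodd
    exact absurd hodd (by rw [Nat.not_odd_iff_even]; exact ⟨_, rfl⟩)

end Setoid

/-! ## Checkerboard colourings of knot diagrams -/

namespace PDCode

variable (D : PDCode)

/-- The map from functions on faces to functions on edges modulo `2` that adds the values on the
two sides of an edge. -/
def faceBoundary : (Quotient D.faceSetoid → ZMod 2) →ₗ[ZMod 2] (Fin D.m → ZMod 2) where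
  toFun f e := f (Quotient.mk _ (e, true)) + f (Quotient.mk _ (e, false))
  map_add' f g := by ext e; simp only [Pi.add_apply]; ring
  map_smul' a f := by ext e; simp only [Pi.smul_apply, smul_eq_mul, RingHom.id_apply]; ring

/-- The incidence matrix modulo `2` of crossings and edges. -/
def incidence : Matrix (Fin D.n) (Fin D.m) (ZMod 2) :=
  Matrix.of fun c e => ∑ t : Bool,
    ((if D.inEdge (c, t) = e then 1 else 0) + (if D.outEdge (c, t) = e then 1 else 0))

theorem incidence_mulVec (h : Fin D.m → ZMod 2) (c : Fin D.n) :
    (D.incidence.mulVec h) c = ∑ j, h (D.edge c j) := by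
  have : (D.incidence.mulVec h) c = ∑ t : Bool, (h (D.inEdge (c, t)) + h (D.outEdge (c, t))) := by
    simp only [Matrix.mulVec, dotProduct, incidence, Matrix.of_apply, Finset.sum_mul, add_mul,
      ite_mul, one_mul, zero_mul]
    rw [Finset.sum_comm]
    simp [Finset.sum_add_distrib]
  rw [this, Fin.sum_univ_four]
  cases hc : D.positive c <;> simp [inEdge, outEdge, hc] <;> ring

/-- The boundary of a boundary vanishes: each corner at `c` lies in one face and is counted for both
of its edges. -/
theorem incidence_mulVec_faceBoundary (f : Quotient D.faceSetoid → ZMod 2) :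
    D.incidence.mulVec (D.faceBoundary f) = 0 := by
  ext c
  rw [incidence_mulVec]
  have h1 : ∀ j, D.faceBoundary f (D.edge c j)
      = f (Quotient.mk _ (D.leftSide c j)) + f (Quotient.mk _ (D.rightSide c j)) := by
    intro j
    simp only [faceBoundary, LinearMap.coe_mk, AddHom.coe_mk, leftSide, rightSide]
    cases D.isOut c j
    · exact add_comm _ _
    · rfl
  have h2 : ∀ j, Quotient.mk D.faceSetoid (D.leftSide c j)
      = Quotient.mk _ (D.rightSide c (j + 1)) :=
    fun j => Quotient.sound (Relation.EqvGen.rel _ _ ⟨c, j, rfl, rfl⟩)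
  simp only [h1, h2, Finset.sum_add_distrib, Pi.zero_apply]
  have h3 := Equiv.sum_comp (Equiv.addRight (1 : Fin 4))
    (fun j => f (Quotient.mk _ (D.rightSide c j)))
  simp only [Equiv.coe_addRight] at h3
  rw [h3]
  exact CharTwo.add_self_eq_zero _

end PDCode

namespace KnotDiagram

variable (D : KnotDiagram)

theorem eq_of_forall_inEdge_eq_outEdge {β : Type*} (p : Fin D.m → β)
    (h : ∀ s, p (D.inEdge s) = p (D.outEdge s)) (e f : Fin D.m) : p e = p f := by
  induction D.single_component e f with
  | rel _ _ h' => obtain ⟨s, rfl, rfl⟩ := h'; exact h s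
  | refl => rfl
  | symm _ _ _ ih => exact ih.symm
  | trans _ _ _ _ _ ih1 ih2 => exact ih1.trans ih2

/-- A crossing has to exist, since the edge of the crossingless circle enters none. Being an
incoming edge is preserved along the knot, so it spreads to every edge. -/
theorem inEdge_bijective (c : Fin D.n) : Function.Bijective D.inEdge := by
  refine ⟨D.in_injective, fun e => ?_⟩
  have h := D.eq_of_forall_inEdge_eq_outEdge (fun e => e ∈ Set.range D.inEdge) (fun s => ?_) e
    (D.inEdge (c, true))
  · exact h.mpr ⟨_, rfl⟩
  · refine propext ⟨fun _ => ?_, fun _ => ⟨_, rfl⟩⟩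
    rw [D.range_eq]
    exact ⟨_, rfl⟩

theorem outEdge_bijective (c : Fin D.n) : Function.Bijective D.outEdge := by
  refine ⟨D.out_injective, fun e => ?_⟩
  have : e ∈ Set.range D.inEdge := (D.inEdge_bijective c).2 e
  rwa [D.range_eq] at this

theorem card_edges (c : Fin D.n) : D.m = 2 * D.n := by
  have := Fintype.card_of_bijective (D.inEdge_bijective c)
  simp only [Fintype.card_prod, Fintype.card_fin, Fintype.card_bool] at this
  omega

/-- A function in the kernel agrees on the two sides of each edge, hence around each crossing, hence
everywhere because the diagram is connected. -/
theorem finrank_ker_faceBoundary_le :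
    Module.finrank (ZMod 2) (LinearMap.ker D.faceBoundary) ≤ 1 := by
  have hone : (fun _ => 1 : Quotient D.faceSetoid → ZMod 2) ∈ LinearMap.ker D.faceBoundary := by
    rw [LinearMap.mem_ker]
    ext e
    exact CharTwo.add_self_eq_zero _
  refine finrank_le_one (⟨_, hone⟩ : LinearMap.ker D.faceBoundary) fun w => ?_
  obtain ⟨f, hf⟩ := w
  rw [LinearMap.mem_ker] at hf
  have hside : ∀ e a b, f (Quotient.mk _ (e, a)) = f (Quotient.mk _ (e, b)) := by
    have : ∀ e, f (Quotient.mk _ (e, true)) = f (Quotient.mk _ (e, false)) := fun e =>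
      CharTwo.add_eq_zero.1 (congrFun hf e)
    intro e a b
    cases a <;> cases b <;> simp [this]
  have hstep : ∀ c j, f (Quotient.mk _ (D.edge c j, true))
      = f (Quotient.mk _ (D.edge c (j + 1), true)) := by
    intro c j
    rw [hside _ true (D.isOut c j), hside _ true (!D.isOut c (j + 1))]
    exact congrArg f (Quotient.sound (Relation.EqvGen.rel _ _ ⟨c, j, rfl, rfl⟩))
  have hcross : ∀ c i j, f (Quotient.mk _ (D.edge c i, true))
      = f (Quotient.mk _ (D.edge c j, true)) := by
    intro c
    have h0 := hstep c 0
    have h1 := hstep c 1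
    have h2 := hstep c 2
    simp only [Fin.isValue, zero_add, show (1 : Fin 4) + 1 = 2 from rfl,
      show (2 : Fin 4) + 1 = 3 from rfl] at h0 h1 h2
    have : ∀ i, f (Quotient.mk _ (D.edge c i, true)) = f (Quotient.mk _ (D.edge c 0, true)) := by
      intro i
      fin_cases i
      · rfl
      · exact h0.symm
      · exact (h0.trans h1).symm
      · exact (h0.trans (h1.trans h2)).symm
    intro i j
    rw [this i, this j]
  have hall : ∀ e e', f (Quotient.mk _ (e, true)) = f (Quotient.mk _ (e', true)) :=
    D.eq_of_forall_inEdge_eq_outEdge (fun e => f (Quotient.mk _ (e, true))) fun s => by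
      obtain ⟨c, t⟩ := s
      cases t <;> cases hc : D.positive c <;>
        simpa [PDCode.inEdge, PDCode.outEdge, hc] using hcross c _ _
  refine ⟨f (Quotient.mk _ (⟨0, D.m_pos⟩, true)), Subtype.ext (funext fun q => ?_)⟩
  induction q using Quotient.inductionOn with
  | h s =>
    obtain ⟨e, a⟩ := s
    simp only [SetLike.mk_smul_mk, Pi.smul_apply, smul_eq_mul, mul_one]
    rw [hside e a true]
    exact hall _ _

/-- A function in this kernel takes equal values at the two ends of each edge, so connectedness
makes it constant. -/
theorem finrank_ker_incidence_transpose_le (c : Fin D.n) :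
    Module.finrank (ZMod 2) (LinearMap.ker D.incidence.transpose.mulVecLin) ≤ 1 := by
  have key : ∀ (g : Fin D.n → ZMod 2) (s t : Fin D.n × Bool), D.inEdge s = D.outEdge t →
      (D.incidence.transpose.mulVec g) (D.inEdge s) = g s.1 + g t.1 := by
    intro g s t hst
    simp only [Matrix.mulVec, dotProduct, PDCode.incidence, Matrix.transpose_apply,
      Matrix.of_apply, Finset.sum_mul, ← Fintype.sum_prod_type', add_mul, Finset.sum_add_distrib,
      ite_mul, one_mul, zero_mul]
    rw [Finset.sum_eq_single s, Finset.sum_eq_single t]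
    · simp [hst]
    · intro u _ hu
      exact if_neg fun h => hu (D.out_injective (h.trans hst))
    · simp
    · intro u _ hu
      exact if_neg fun h => hu (D.in_injective h)
    · simp
  have hone : (fun _ => 1 : Fin D.n → ZMod 2)
      ∈ LinearMap.ker D.incidence.transpose.mulVecLin := by
    rw [LinearMap.mem_ker, Matrix.mulVecLin_apply]
    ext e
    obtain ⟨s, rfl⟩ := (D.inEdge_bijective c).2 e
    obtain ⟨t, ht⟩ := (D.outEdge_bijective c).2 (D.inEdge s)
    rw [key _ s t ht.symm]
    exact CharTwo.add_self_eq_zero _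
  refine finrank_le_one (⟨_, hone⟩ : LinearMap.ker D.incidence.transpose.mulVecLin) fun w => ?_
  obtain ⟨g, hg⟩ := w
  rw [LinearMap.mem_ker, Matrix.mulVecLin_apply] at hg
  have hst : ∀ s t, D.inEdge s = D.outEdge t → g s.1 = g t.1 := by
    intro s t h
    have := congrFun hg (D.inEdge s)
    rw [key g s t h] at this
    exact CharTwo.add_eq_zero.1 this
  let einv := Equiv.ofBijective D.inEdge (D.inEdge_bijective c)
  have hall := D.eq_of_forall_inEdge_eq_outEdge (fun e => g (einv.symm e).1) fun s => by
    have h1 : einv.symm (D.inEdge s) = s := einv.symm_apply_apply s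
    have h2 : D.inEdge (einv.symm (D.outEdge s)) = D.outEdge s := einv.apply_symm_apply _
    rw [h1]
    exact (hst _ _ h2).symm
  refine ⟨g c, Subtype.ext (funext fun c' => ?_)⟩
  have h3 : ∀ s, einv.symm (D.inEdge s) = s := fun s => einv.symm_apply_apply s
  have := hall (D.inEdge (c, true)) (D.inEdge (c', true))
  simp only [h3] at this
  simpa using this

/-- The faces of a knot diagram have a checkerboard colouring. -/
theorem exists_faceBoundary_eq_one : ∃ f, D.faceBoundary f = fun _ => 1 := by
  have hF : Module.finrank (ZMod 2) (Quotient D.faceSetoid → ZMod 2) = D.n + 2 := by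
    have : Fintype (Quotient D.faceSetoid) := Fintype.ofFinite _
    rw [Module.finrank_fintype_fun_eq_card, ← Nat.card_eq_fintype_card, D.planar]
  have hrange : D.n + 1 ≤ Module.finrank (ZMod 2) (LinearMap.range D.faceBoundary) := by
    have h1 := D.faceBoundary.finrank_range_add_finrank_ker
    have h2 := D.finrank_ker_faceBoundary_le
    omega
  -- This is the vanishing of `H_1` of the sphere modulo `2`. The sum of all edges is a cycle
  -- because crossings are four-valent, so it bounds.
  suffices h : LinearMap.range D.faceBoundary = LinearMap.ker D.incidence.mulVecLin by
    have hone : (fun _ => 1 : Fin D.m → ZMod 2) ∈ LinearMap.ker D.incidence.mulVecLin := by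
      rw [LinearMap.mem_ker, Matrix.mulVecLin_apply]
      ext c
      rw [PDCode.incidence_mulVec]
      rfl
    rwa [← h] at hone
  -- The image has dimension at least `n + 1` by Euler's formula. The kernel has at most that: with
  -- crossings there are `2 * n` edges and the incidence matrix has rank at least `n - 1`.
  refine Submodule.eq_of_le_of_finrank_le ?_ (le_trans ?_ hrange)
  · rintro _ ⟨f, rfl⟩
    exact D.incidence_mulVec_faceBoundary f
  have h1 := D.incidence.mulVecLin.finrank_range_add_finrank_ker
  rw [Module.finrank_fintype_fun_eq_card, Fintype.card_fin] at h1
  by_cases hn : D.n = 0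
  · have hm : D.m ≤ 1 := by
      have := D.eq_of_forall_inEdge_eq_outEdge id fun s => (Fin.cast hn s.1).elim0
      by_contra! hm
      have h2 := congrArg Fin.val (this ⟨0, by omega⟩ ⟨1, hm⟩)
      simp at h2
    omega
  · let c : Fin D.n := ⟨0, Nat.pos_of_ne_zero hn⟩
    have h2 := D.incidence.transpose.mulVecLin.finrank_range_add_finrank_ker
    have h3 := D.finrank_ker_incidence_transpose_le c
    have h4 := D.incidence.rank_transpose
    rw [Module.finrank_fintype_fun_eq_card, Fintype.card_fin] at h2
    rw [Matrix.rank, Matrix.rank] at h4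
    have := D.card_edges c
    omega

end KnotDiagram

/-! ## Seifert colourings and the parity of the number of circles -/

namespace Equiv.Perm

theorem sameCycle_setoid_le {α : Type*} {f : Equiv.Perm α} {r : Setoid α}
    (h : ∀ x, r x (f x)) : SameCycle.setoid f ≤ r := by
  have hpow : ∀ (k : ℕ) x, r x ((f ^ k) x) := by
    intro k
    induction k with
    | zero => exact fun x => r.refl' x
    | succ k ih =>
      intro x
      rw [pow_succ', mul_apply]
      exact r.trans' (ih x) (h _)
  rintro x y ⟨k, rfl⟩
  obtain ⟨k, rfl | rfl⟩ := k.eq_nat_or_neg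
  · exact hpow k x
  · have := hpow k ((f ^ (-(k : ℤ))) x)
    rw [zpow_neg, zpow_natCast, ← mul_apply, mul_inv_cancel, one_apply] at this
    rw [zpow_neg, zpow_natCast]
    exact r.symm' this

/-- The composite is `A.symm.trans B` times the conjugate of `w` by `A`, which has the sign of `w`.
-/
theorem sign_symm_trans_trans_eq_mul {α β : Type*} [Fintype α] [DecidableEq α] [Fintype β]
    [DecidableEq β] (A B : β ≃ α) (w : Equiv.Perm β) :
    sign (A.symm.trans (w.trans B) : Equiv.Perm α)
      = sign (A.symm.trans B : Equiv.Perm α) * sign w := by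
  rw [← sign_permCongr A w, ← sign_mul]
  congr 1
  ext x
  simp [Equiv.permCongr_apply]

end Equiv.Perm

namespace PDCode

variable (D : PDCode)

/-- The oriented resolution. -/
def seifertVertex : D.Vertex := fun c => !D.positive c

/-- A `2`-colouring of the edges that is constant on the circles of the oriented resolution, with
the two circles at each crossing coloured differently. -/
structure IsSeifertColouring (κ : Fin D.m → Fin 2) : Prop where
  ne : ∀ c, κ (D.edge c 0) ≠ κ (D.edge c 2)
  eq_one : ∀ c, κ (D.edge c 1) = if D.positive c then κ (D.edge c 0) else κ (D.edge c 2)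
  eq_three : ∀ c, κ (D.edge c 3) = if D.positive c then κ (D.edge c 2) else κ (D.edge c 0)

variable {D} in
theorem circleSetoid_le {v : D.Vertex} {s : Setoid (Fin D.m)}
    (h0 : ∀ c, v c = false → s (D.edge c 0) (D.edge c 1) ∧ s (D.edge c 2) (D.edge c 3))
    (h1 : ∀ c, v c = true → s (D.edge c 1) (D.edge c 2) ∧ s (D.edge c 3) (D.edge c 0)) :
    D.circleSetoid v ≤ s := by
  refine Setoid.eqvGen_le fun e f hef => ?_
  obtain ⟨c, ⟨hv, ⟨rfl, rfl⟩ | ⟨rfl, rfl⟩⟩ | ⟨hv, ⟨rfl, rfl⟩ | ⟨rfl, rfl⟩⟩⟩ := hef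
  · exact (h0 c hv).1
  · exact (h0 c hv).2
  · exact (h1 c hv).1
  · exact (h1 c hv).2

theorem circleSetoid_false {v : D.Vertex} {c : Fin D.n} (h : v c = false) :
    D.circleSetoid v (D.edge c 0) (D.edge c 1) ∧ D.circleSetoid v (D.edge c 2) (D.edge c 3) :=
  ⟨Relation.EqvGen.rel _ _ ⟨c, Or.inl ⟨h, Or.inl ⟨rfl, rfl⟩⟩⟩,
    Relation.EqvGen.rel _ _ ⟨c, Or.inl ⟨h, Or.inr ⟨rfl, rfl⟩⟩⟩⟩

theorem circleSetoid_true {v : D.Vertex} {c : Fin D.n} (h : v c = true) :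
    D.circleSetoid v (D.edge c 1) (D.edge c 2) ∧ D.circleSetoid v (D.edge c 3) (D.edge c 0) :=
  ⟨Relation.EqvGen.rel _ _ ⟨c, Or.inr ⟨h, Or.inl ⟨rfl, rfl⟩⟩⟩,
    Relation.EqvGen.rel _ _ ⟨c, Or.inr ⟨h, Or.inr ⟨rfl, rfl⟩⟩⟩⟩

/-- The edges are oriented so that the orientation agrees with that of the knot where the colour
is `1`. These are the two incoming edges at each crossing, indexed by their colours. -/
def head (κ : Fin D.m → Fin 2) (s : Fin D.n × Bool) : Fin D.m :=
  if s.2 then D.inEdge (s.1, decide (κ (D.edge s.1 0) = 0))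
  else D.outEdge (s.1, decide (κ (D.edge s.1 0) = 0))

/-- The two outgoing edges at each crossing for the orientation of `head`. -/
def tail (κ : Fin D.m → Fin 2) (s : Fin D.n × Bool) : Fin D.m :=
  if s.2 then D.outEdge (s.1, !decide (κ (D.edge s.1 0) = 0))
  else D.inEdge (s.1, !decide (κ (D.edge s.1 0) = 0))

/-- The permutation of the indices of `head` that makes the smoothing `v` join each head to the
tail with the permuted index. -/
def twist (v : D.Vertex) : Equiv.Perm (Fin D.n × Bool) :=
  Equiv.prodCongrRight fun c => if v c = D.seifertVertex c then 1 else Equiv.swap true false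

variable {D}

theorem IsSeifertColouring.colour_head {κ : Fin D.m → Fin 2} (hκ : D.IsSeifertColouring κ)
    (s : Fin D.n × Bool) : κ (D.head κ s) = if s.2 then 1 else 0 := by
  obtain ⟨c, t⟩ := s
  have h0 := hκ.ne c
  have h1 := hκ.eq_one c
  have h3 := hκ.eq_three c
  cases t <;> cases hc : D.positive c <;>
    simp only [hc, if_true, if_false, Bool.false_eq_true] at h1 h3 <;>
    by_cases hk : κ (D.edge c 0) = 0 <;>
    simp [head, inEdge, outEdge, hc, hk, h1, h3] <;> omega

theorem IsSeifertColouring.colour_tail {κ : Fin D.m → Fin 2} (hκ : D.IsSeifertColouring κ)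
    (s : Fin D.n × Bool) : κ (D.tail κ s) = if s.2 then 1 else 0 := by
  obtain ⟨c, t⟩ := s
  have h0 := hκ.ne c
  have h1 := hκ.eq_one c
  have h3 := hκ.eq_three c
  cases t <;> cases hc : D.positive c <;>
    simp only [hc, if_true, if_false, Bool.false_eq_true] at h1 h3 <;>
    by_cases hk : κ (D.edge c 0) = 0 <;>
    simp [tail, inEdge, outEdge, hc, hk, h1, h3] <;> omega

/-- Reversing the edges of colour `0` makes incoming and outgoing edges alternate around each
crossing, so both smoothings respect the new orientation. With the converse below, the circles of
`v` are the orbits of a permutation. -/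
theorem circleSetoid_head_tail {κ : Fin D.m → Fin 2}
    (v : D.Vertex) (s : Fin D.n × Bool) :
    D.circleSetoid v (D.head κ s) (D.tail κ (D.twist v s)) := by
  obtain ⟨c, t⟩ := s
  have hs : ∀ x y, D.circleSetoid v x y → D.circleSetoid v y x := fun _ _ h =>
    (D.circleSetoid v).symm' h
  cases hv : v c
  · obtain ⟨h1, h2⟩ := D.circleSetoid_false hv
    have h1' := hs _ _ h1
    have h2' := hs _ _ h2
    cases t <;> cases hc : D.positive c <;> by_cases hk : κ (D.edge c 0) = 0 <;>
    simpa [head, tail, twist, seifertVertex, inEdge, outEdge, hc, hk, hv]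
  · obtain ⟨h1, h2⟩ := D.circleSetoid_true hv
    have h1' := hs _ _ h1
    have h2' := hs _ _ h2
    cases t <;> cases hc : D.positive c <;> by_cases hk : κ (D.edge c 0) = 0 <;>
    simpa [head, tail, twist, seifertVertex, inEdge, outEdge, hc, hk, hv]

theorem circleSetoid_le_of_head_tail {κ : Fin D.m → Fin 2}
    (v : D.Vertex) {r : Setoid (Fin D.m)}
    (h : ∀ s, r (D.head κ s) (D.tail κ (D.twist v s))) : D.circleSetoid v ≤ r := by
  have hs : ∀ x y, r x y → r y x := fun _ _ h => r.symm' h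
  refine circleSetoid_le (fun c hv => ?_) (fun c hv => ?_)
  all_goals
    have h1 := h (c, true)
    have h2 := h (c, false)
    cases hc : D.positive c <;> by_cases hk : κ (D.edge c 0) = 0 <;>
    simp [head, tail, twist, seifertVertex, inEdge, outEdge, hc, hk, hv] at h1 h2 <;>
    simp [h1, h2, hs _ _ h1, hs _ _ h2]

end PDCode

namespace KnotDiagram

variable (D : KnotDiagram)

/-- An edge gets the checkerboard colour of the face on its left, up to a constant. -/
theorem exists_isSeifertColouring (b : Fin D.m) : ∃ κ, D.IsSeifertColouring κ ∧ κ b = 1 := by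
  obtain ⟨f, hf⟩ := D.exists_faceBoundary_eq_one
  have hf' : ∀ e, f (Quotient.mk _ (e, false)) = f (Quotient.mk _ (e, true)) + 1 := by
    intro e
    have : f (Quotient.mk _ (e, true)) + f (Quotient.mk _ (e, false)) = 1 := congrFun hf e
    rw [← this, ← add_assoc, CharTwo.add_self_eq_zero, zero_add]
  have hstep : ∀ c j, f (Quotient.mk _ (D.leftSide c j))
      = f (Quotient.mk _ (D.rightSide c (j + 1))) := fun c j =>
    congrArg f (Quotient.sound (Relation.EqvGen.rel _ _ ⟨c, j, rfl, rfl⟩))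
  -- The last two summands normalise the value at `b` to `1`. `ZMod 2` unfolds to `Fin 2`.
  let κ : Fin D.m → ZMod 2 := fun e =>
    f (Quotient.mk _ (e, true)) + f (Quotient.mk _ (b, true)) + 1
  have hκ : ∀ c, κ (D.edge c 0) ≠ κ (D.edge c 2) ∧
      κ (D.edge c 1) = (if D.positive c then κ (D.edge c 0) else κ (D.edge c 2)) ∧
      κ (D.edge c 3) = (if D.positive c then κ (D.edge c 2) else κ (D.edge c 0)) := by
    intro c
    have h0 := hstep c 0
    have h1 := hstep c 1
    have h2 := hstep c 2
    have h3 := hstep c 3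
    simp only [Fin.isValue, zero_add, show (1 : Fin 4) + 1 = 2 from rfl,
      show (2 : Fin 4) + 1 = 3 from rfl, show (3 : Fin 4) + 1 = 0 from rfl] at h0 h1 h2 h3
    cases hc : D.positive c <;>
    simp only [PDCode.leftSide, PDCode.rightSide, PDCode.isOut, hc, Fin.isValue, Fin.reduceEq,
      if_true, if_false, Bool.not_true, Bool.not_false, hf'] at h0 h1 h2 h3 <;>
    simp only [κ, if_true, if_false, Bool.false_eq_true] <;>
    revert h0 h1 h2 h3 <;>
    generalize f (Quotient.mk _ (D.edge c 0, true)) = a0 <;>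
    generalize f (Quotient.mk _ (D.edge c 1, true)) = a1 <;>
    generalize f (Quotient.mk _ (D.edge c 2, true)) = a2 <;>
    generalize f (Quotient.mk _ (D.edge c 3, true)) = a3 <;>
    generalize f (Quotient.mk _ (b, true)) = b <;>
    revert a0 a1 a2 a3 b <;> decide
  refine ⟨κ, ⟨fun c => (hκ c).1, fun c => (hκ c).2.1, fun c => (hκ c).2.2⟩, ?_⟩
  show f (Quotient.mk _ (b, true)) + f (Quotient.mk _ (b, true)) + 1 = 1
  rw [CharTwo.add_self_eq_zero, zero_add]

variable {D}

theorem head_injective {κ : Fin D.m → Fin 2} (hκ : D.IsSeifertColouring κ) :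
    Function.Injective (D.head κ) := by
  rintro ⟨c, t⟩ ⟨c', t'⟩ h
  have h1 := congrArg κ h
  rw [hκ.colour_head, hκ.colour_head] at h1
  cases t <;> cases t' <;> simp at h1
  · have := D.out_injective h
    simp only [Prod.mk.injEq] at this
    rw [this.1]
  · have := D.in_injective h
    simp only [Prod.mk.injEq] at this
    rw [this.1]

theorem tail_injective {κ : Fin D.m → Fin 2} (hκ : D.IsSeifertColouring κ) :
    Function.Injective (D.tail κ) := by
  rintro ⟨c, t⟩ ⟨c', t'⟩ h
  have h1 := congrArg κ h
  rw [hκ.colour_tail, hκ.colour_tail] at h1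
  cases t <;> cases t' <;> simp at h1
  · have := D.in_injective h
    simp only [Prod.mk.injEq] at this
    rw [this.1]
  · have := D.out_injective h
    simp only [Prod.mk.injEq] at this
    rw [this.1]

variable (D)

theorem bijective_of_injective {g : Fin D.n × Bool → Fin D.m} (c : Fin D.n)
    (hg : Function.Injective g) : Function.Bijective g := by
  rw [Fintype.bijective_iff_injective_and_card]
  refine ⟨hg, ?_⟩
  rw [← Fintype.card_of_bijective (D.inEdge_bijective c)]

theorem prod_ite_neg_one (p : Fin D.n → Prop) [DecidablePred p] :
    ∏ c, (if p c then (-1 : ℤˣ) else 1) = (-1) ^ (Finset.univ.filter p).card := by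
  simp [Finset.prod_ite]

/-- There is one transposition for each crossing where `v` differs from the oriented resolution;
modulo `2` their number is `height v + nMinus`. -/
theorem sign_twist (v : D.Vertex) :
    Equiv.Perm.sign (D.twist v) = (-1) ^ (D.height v + D.nMinus) := by
  rw [PDCode.twist, Equiv.Perm.sign_prodCongrRight, pow_add, PDCode.height, PDCode.nMinus,
    ← D.prod_ite_neg_one, ← D.prod_ite_neg_one, ← Finset.prod_mul_distrib]
  refine Finset.prod_congr rfl fun c _ => ?_
  cases hv : v c <;> cases hc : D.positive c <;> simp [PDCode.seifertVertex, hc]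

theorem height_seifertVertex : D.height D.seifertVertex = D.nMinus := by
  simp [PDCode.height, PDCode.nMinus, PDCode.seifertVertex]

theorem nPlus_add_nMinus : D.nPlus + D.nMinus = D.n := by
  have := Finset.card_filter_add_card_filter_not (s := (Finset.univ : Finset (Fin D.n)))
    (fun c => D.positive c = true)
  simpa [PDCode.nPlus, PDCode.nMinus] using this

/-- Going straight through the crossings is a permutation of the edges with a single orbit, the
knot. Swapping the two outgoing edges at all `n` crossings turns its orbits into the Seifert
circles. -/
theorem neg_one_pow_card_circle_seifertVertex (c : Fin D.n) :
    (-1 : ℤˣ) ^ (D.m + Nat.card (D.Circle D.seifertVertex)) = (-1) ^ (D.m + 1 + D.n) := by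
  let I := Equiv.ofBijective D.inEdge (D.inEdge_bijective c)
  let O := Equiv.ofBijective D.outEdge (D.outEdge_bijective c)
  let w : Equiv.Perm (Fin D.n × Bool) := Equiv.prodCongrRight fun _ => Equiv.swap true false
  have hw : Equiv.Perm.sign w = (-1) ^ D.n := by
    simp [w, Equiv.Perm.sign_prodCongrRight]
  have h1 := Equiv.Perm.sign_symm_trans_trans_eq_mul I O w
  have hI : ∀ s, I.symm (D.inEdge s) = s := I.symm_apply_apply
  have hsetoid : Equiv.Perm.SameCycle.setoid (I.symm.trans (w.trans O) : Equiv.Perm (Fin D.m))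
      = D.circleSetoid D.seifertVertex := by
    apply le_antisymm
    · refine Equiv.Perm.sameCycle_setoid_le fun x => ?_
      obtain ⟨⟨c, t⟩, rfl⟩ := (D.inEdge_bijective c).2 x
      have : (I.symm.trans (w.trans O)) (D.inEdge (c, t)) = D.outEdge (w (c, t)) := by
        simp [hI, O]
      rw [this]
      have hs : ∀ x y, D.circleSetoid D.seifertVertex x y → D.circleSetoid D.seifertVertex y x :=
        fun _ _ h => (D.circleSetoid _).symm' h
      cases hc : D.positive c
      · obtain ⟨h1, h2⟩ := D.circleSetoid_true (v := D.seifertVertex) (c := c)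
          (by simp [PDCode.seifertVertex, hc])
        cases t <;> simp [w, PDCode.inEdge, PDCode.outEdge, hc, h1, hs _ _ h2]
      · obtain ⟨h1, h2⟩ := D.circleSetoid_false (v := D.seifertVertex) (c := c)
          (by simp [PDCode.seifertVertex, hc])
        cases t <;> simp [w, PDCode.inEdge, PDCode.outEdge, hc, h1, hs _ _ h2]
    · have hrel : ∀ s, Equiv.Perm.SameCycle.setoid (I.symm.trans (w.trans O)) (D.inEdge s)
          (D.outEdge (w s)) := by
        intro s
        refine ⟨1, ?_⟩
        simp [hI, O]
      have hs : ∀ x y, Equiv.Perm.SameCycle.setoid (I.symm.trans (w.trans O)) x y →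
          Equiv.Perm.SameCycle.setoid (I.symm.trans (w.trans O)) y x :=
        fun _ _ h => (Equiv.Perm.SameCycle.setoid _).symm' h
      refine PDCode.circleSetoid_le (fun c hv => ?_) (fun c hv => ?_)
      all_goals
        have h1 := hrel (c, true)
        have h2 := hrel (c, false)
        cases hc : D.positive c <;> simp [PDCode.seifertVertex, hc] at hv
        simp only [w, PDCode.inEdge, PDCode.outEdge, hc, Equiv.prodCongrRight_apply,
          Equiv.swap_apply_left, Equiv.swap_apply_right, if_true, if_false, Bool.false_eq_true]
          at h1 h2
      · exact ⟨h2, hs _ _ h1⟩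
      · exact ⟨h1, hs _ _ h2⟩
  have hone : Nat.card (Quotient (Equiv.Perm.SameCycle.setoid
      (I.symm.trans O : Equiv.Perm (Fin D.m)))) = 1 := by
    rw [Nat.card_eq_one_iff_unique]
    refine ⟨⟨fun x y => ?_⟩, ⟨Quotient.mk _ ⟨0, D.m_pos⟩⟩⟩
    induction x using Quotient.inductionOn with
    | h e =>
      induction y using Quotient.inductionOn with
      | h f =>
        refine D.eq_of_forall_inEdge_eq_outEdge (fun e => Quotient.mk _ e) (fun s => ?_) e f
        refine Quotient.sound ⟨1, ?_⟩
        simp [hI, O]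
  rw [Equiv.Perm.sign_eq_neg_one_pow_card_add_card_orbits,
    Equiv.Perm.sign_eq_neg_one_pow_card_add_card_orbits, hone, hsetoid, hw, Fintype.card_fin,
    ← pow_add] at h1
  exact h1

/-- The permutations for `v` and for the oriented resolution differ by `twist v`, so the Seifert
case determines the parity at every vertex. -/
theorem neg_one_pow_card_circle (c : Fin D.n) (v : D.Vertex) :
    (-1 : ℤˣ) ^ (D.m + Nat.card (D.Circle v))
      = (-1) ^ (D.m + 1 + D.n) * (-1) ^ (D.height v + D.nMinus) := by
  obtain ⟨κ, hκ, -⟩ := D.exists_isSeifertColouring (D.edge c 0)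
  let H := Equiv.ofBijective (D.head κ) (D.bijective_of_injective c (head_injective hκ))
  let T := Equiv.ofBijective (D.tail κ) (D.bijective_of_injective c (tail_injective hκ))
  have hH : ∀ s, H.symm (D.head κ s) = s := H.symm_apply_apply
  have hsetoid : ∀ v : D.Vertex, Equiv.Perm.SameCycle.setoid
      (H.symm.trans ((D.twist v).trans T) : Equiv.Perm (Fin D.m)) = D.circleSetoid v := by
    intro v
    apply le_antisymm
    · refine Equiv.Perm.sameCycle_setoid_le fun x => ?_
      obtain ⟨s, rfl⟩ := (D.bijective_of_injective c (head_injective hκ)).2 x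
      have : (H.symm.trans ((D.twist v).trans T)) (D.head κ s) = D.tail κ (D.twist v s) := by
        simp [hH, T]
      rw [this]
      exact PDCode.circleSetoid_head_tail v s
    · refine PDCode.circleSetoid_le_of_head_tail (κ := κ) v fun s => ?_
      refine ⟨1, ?_⟩
      simp [hH, T]
  have h : ∀ v : D.Vertex, (-1 : ℤˣ) ^ (D.m + Nat.card (D.Circle v))
      = Equiv.Perm.sign (H.symm.trans T : Equiv.Perm (Fin D.m))
        * (-1) ^ (D.height v + D.nMinus) := by
    intro v
    rw [← D.sign_twist, ← Equiv.Perm.sign_symm_trans_trans_eq_mul,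
      Equiv.Perm.sign_eq_neg_one_pow_card_add_card_orbits, hsetoid, Fintype.card_fin]
  have h0 := h D.seifertVertex
  rw [D.height_seifertVertex, ← two_mul, pow_mul, neg_one_sq, one_pow, mul_one,
    D.neg_one_pow_card_circle_seifertVertex c] at h0
  rw [h, h0]

/-- For a knot all quantum degrees are odd. -/
theorem odd_card_circle_add_height_add_nPlus (v : D.Vertex) :
    Odd (Nat.card (D.Circle v) + D.height v + D.nPlus) := by
  by_cases hn : D.n = 0
  · have h1 : D.height v = 0 := by
      rw [PDCode.height, Finset.card_eq_zero, Finset.filter_eq_empty_iff]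
      exact fun c => (Fin.cast hn c).elim0
    have h2 : D.nPlus = 0 := by
      rw [PDCode.nPlus, Finset.card_eq_zero, Finset.filter_eq_empty_iff]
      exact fun c => (Fin.cast hn c).elim0
    have h3 : Nat.card (D.Circle v) = 1 := by
      rw [Nat.card_eq_one_iff_unique]
      refine ⟨⟨fun x y => ?_⟩, ⟨Quotient.mk _ ⟨0, D.m_pos⟩⟩⟩
      induction x using Quotient.inductionOn with
      | h e =>
        induction y using Quotient.inductionOn with
        | h f =>
          exact D.eq_of_forall_inEdge_eq_outEdge (fun e => Quotient.mk _ e)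
            (fun s => (Fin.cast hn s.1).elim0) e f
    rw [h1, h2, h3]
    exact odd_one
  · have h := D.neg_one_pow_card_circle ⟨0, Nat.pos_of_ne_zero hn⟩ v
    have h2 := D.nPlus_add_nMinus
    have h3 : (-1 : ℤˣ) ^ (Nat.card (D.Circle v) + D.height v + D.nPlus + 1) = 1 := by
      have h4 : (-1 : ℤˣ) ^ (Nat.card (D.Circle v) + D.height v + D.nPlus + 1) * (-1) ^ (2 * D.m)
          = (-1) ^ (D.m + Nat.card (D.Circle v)) * (-1) ^ (D.m + D.height v + D.nPlus + 1) := by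
        rw [← pow_add, ← pow_add]
        congr 1
        ring
      rw [h, ← h2, ← pow_add (-1 : ℤˣ) (D.m + 1 + (D.nPlus + D.nMinus)),
        ← pow_add (-1 : ℤˣ) (_ + _) (D.m + D.height v + D.nPlus + 1),
        show D.m + 1 + (D.nPlus + D.nMinus)
        + (D.height v + D.nMinus) + (D.m + D.height v + D.nPlus + 1)
        = 2 * (D.m + 1 + D.nPlus + D.nMinus + D.height v) by ring, pow_mul, pow_mul] at h4
      simpa [pow_add] using h4
    rw [neg_one_pow_eq_one_iff_even (by decide)] at h3
    rcases Nat.even_or_odd (Nat.card (D.Circle v) + D.height v + D.nPlus) with h6 | h6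
    · exact absurd h3 (by rw [Nat.not_even_iff_odd]; exact h6.add_one)
    · exact h6

end KnotDiagram

/-! ## Evaluation of cochains at colourings -/

namespace PDCode

variable (D : PDCode)

/-- The smoothings agree away from `c`, and once slots `0` and `2` are joined, either smoothing of
`c` joins all four slots. -/
theorem joinPair_circleSetoid_update {v : D.Vertex} {c : Fin D.n} (hv : v c = false) :
    (D.circleSetoid v).joinPair (D.edge c 0) (D.edge c 2)
      = (D.circleSetoid (Function.update v c true)).joinPair (D.edge c 0) (D.edge c 2) := by
  set w := Function.update v c true with hw
  have hwc : w c = true := by simp [hw]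
  have hne : ∀ c', c' ≠ c → w c' = v c' := fun c' h => by simp [hw, h]
  apply le_antisymm
  · set s := (D.circleSetoid w).joinPair (D.edge c 0) (D.edge c 2) with hs
    have hle : D.circleSetoid w ≤ s := Setoid.le_joinPair _ _ _
    have h02 : s (D.edge c 0) (D.edge c 2) := Setoid.joinPair_pair _ _ _
    obtain ⟨h12, h30⟩ := D.circleSetoid_true hwc
    refine Setoid.joinPair_le (circleSetoid_le (fun c' hc' => ?_) (fun c' hc' => ?_)) h02
    · by_cases h : c' = c
      · subst h
        exact ⟨s.trans' h02 (s.symm' (hle h12)), s.trans' (s.symm' h02) (s.symm' (hle h30))⟩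
      · obtain ⟨h1, h2⟩ := D.circleSetoid_false ((hne c' h).trans hc')
        exact ⟨hle h1, hle h2⟩
    · have h : c' ≠ c := fun h => by simp [h, hv] at hc'
      obtain ⟨h1, h2⟩ := D.circleSetoid_true ((hne c' h).trans hc')
      exact ⟨hle h1, hle h2⟩
  · set s := (D.circleSetoid v).joinPair (D.edge c 0) (D.edge c 2) with hs
    have hle : D.circleSetoid v ≤ s := Setoid.le_joinPair _ _ _
    have h02 : s (D.edge c 0) (D.edge c 2) := Setoid.joinPair_pair _ _ _
    obtain ⟨h01, h23⟩ := D.circleSetoid_false hv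
    refine Setoid.joinPair_le (circleSetoid_le (fun c' hc' => ?_) (fun c' hc' => ?_)) h02
    · have h : c' ≠ c := fun h => by simp [h, hwc] at hc'
      obtain ⟨h1, h2⟩ := D.circleSetoid_false ((hne c' h).symm.trans hc')
      exact ⟨hle h1, hle h2⟩
    · by_cases h : c' = c
      · subst h
        exact ⟨s.trans' (s.symm' (hle h01)) h02, s.trans' (s.symm' (hle h23)) (s.symm' h02)⟩
      · obtain ⟨h1, h2⟩ := D.circleSetoid_true ((hne c' h).symm.trans hc')
        exact ⟨hle h1, hle h2⟩

theorem height_update {v : D.Vertex} {c : Fin D.n} (hv : v c = false) :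
    D.height (Function.update v c true) = D.height v + 1 := by
  have : (Finset.univ.filter fun c' => Function.update v c true c' = true)
      = insert c (Finset.univ.filter fun c' => v c' = true) := by
    ext c'
    by_cases h : c' = c <;> simp [h]
  rw [height, height, this, Finset.card_insert_of_notMem (by simp [hv])]

/-- The colouring `κ` is constant on the circles of the smoothing `v`. -/
def IsCompatible (v : D.Vertex) (κ : Fin D.m → Fin 2) : Prop :=
  ∀ e f, D.circleSetoid v e f → κ e = κ f

theorem isCompatible_label (σ : D.Generator) : D.IsCompatible σ.1 (D.label σ) :=
  fun _ _ h => congrArg σ.2 (Quotient.sound h)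

theorem circle_eq_iff {v : D.Vertex} {e f : Fin D.m} :
    D.circle v e = D.circle v f ↔ D.circleSetoid v e f :=
  ⟨fun h => Quotient.exact h, fun h => Quotient.sound h⟩

open Classical in
-- Labels of circles correspond to compatible functions on edges, so exactly one term survives.
theorem sum_ite_forall_eq {β : Type*} [AddCommMonoid β] {v : D.Vertex} {L : Fin D.m → Fin 2}
    (hL : D.IsCompatible v L) (F : (Fin D.m → Fin 2) → β) :
    (∑ l : D.Circle v → Fin 2, if ∀ e, D.label ⟨v, l⟩ e = L e then F (D.label ⟨v, l⟩) else 0)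
      = F L := by
  let l₀ : D.Circle v → Fin 2 := Quotient.lift L hL
  have h0 : D.label ⟨v, l₀⟩ = L := rfl
  rw [Finset.sum_eq_single l₀]
  · rw [if_pos fun e => congrFun h0 e, h0]
  · intro l _ hl
    refine if_neg fun h => hl (funext fun C => ?_)
    induction C using Quotient.inductionOn with
    | h e => exact h e
  · simp

/-- The scalar by which the edge of the cube at `v` in direction `c` acts on the idempotent that
has colour `k` near `c`. -/
def edgeWeight (v : D.Vertex) (c : Fin D.n) (k : Fin 2) : ℤ :=
  open Classical in
  if D.circle v (D.edge c 0) = D.circle v (D.edge c 2) then (if k = 1 then 1 else -1) else 1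

open Classical in
-- The left side is the value of `Δ (x ^ a)` at the point `(k₀, k₂)`. It reflects that `Δ` sends `x`
-- to `x ⊗ x` and `1 - x` to `-(1 - x) ⊗ (1 - x)`.
theorem sum_comulCoeff (a k₀ k₂ : Fin 2) :
    (∑ x : Fin 2, ∑ y : Fin 2, if x ≤ k₀ ∧ y ≤ k₂ then comulCoeff a x y else 0)
      = if k₀ = k₂ ∧ a ≤ k₀ then (if k₀ = 1 then 1 else -1) else 0 := by
  simp only [Fin.sum_univ_two]
  fin_cases a <;> fin_cases k₀ <;> fin_cases k₂ <;> simp [comulCoeff]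

end PDCode

/-! ### Splits, merges and the edge maps in idempotent coordinates -/

namespace KnotDiagram

variable (D : KnotDiagram)

/-- An edge of the cube of resolutions splits a circle or merges two circles. -/
theorem circleSetoid_iff_not_update {v : D.Vertex} {c : Fin D.n} (hv : v c = false) :
    D.circleSetoid v (D.edge c 0) (D.edge c 2) ↔
      ¬ D.circleSetoid (Function.update v c true) (D.edge c 0) (D.edge c 2) := by
  -- The height changes by one along the edge, so the number of circles changes parity; one circle
  -- cannot be resmoothed into one circle.
  refine Setoid.rel_iff_not_rel_of_joinPair_eq (D.joinPair_circleSetoid_update hv) ?_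
  have h1 := D.odd_card_circle_add_height_add_nPlus v
  have h2 := D.odd_card_circle_add_height_add_nPlus (Function.update v c true)
  rw [D.height_update hv] at h2
  have h3 := h1.add_odd h2
  rw [show Nat.card (D.Circle v) + D.height v + D.nPlus
    + (Nat.card (D.Circle (Function.update v c true)) + (D.height v + 1) + D.nPlus)
    = (Nat.card (D.Circle v) + Nat.card (D.Circle (Function.update v c true)) + 1)
      + 2 * (D.height v + D.nPlus) by ring] at h3
  have h4 : Even (Nat.card (D.Circle v)
      + Nat.card (D.Circle (Function.update v c true)) + 1) :=
    (Nat.even_add.1 h3).2 (even_two_mul _)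
  rcases Nat.even_or_odd (Nat.card (D.Circle v)
    + Nat.card (D.Circle (Function.update v c true))) with h | h
  · exact absurd h4 (by rw [Nat.not_even_iff_odd]; exact h.add_one)
  · exact h

theorem circleSetoid_of_merge {v : D.Vertex} {c : Fin D.n} (hv : v c = false)
    (h : ¬ D.circleSetoid v (D.edge c 0) (D.edge c 2)) :
    D.circleSetoid (Function.update v c true)
      = (D.circleSetoid v).joinPair (D.edge c 0) (D.edge c 2) := by
  rw [D.joinPair_circleSetoid_update hv, Setoid.joinPair_eq_self]
  by_contra h'
  exact h ((D.circleSetoid_iff_not_update hv).2 h')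

theorem circleSetoid_of_split {v : D.Vertex} {c : Fin D.n} (hv : v c = false)
    (h : D.circleSetoid v (D.edge c 0) (D.edge c 2)) :
    D.circleSetoid v
      = (D.circleSetoid (Function.update v c true)).joinPair (D.edge c 0) (D.edge c 2) := by
  rw [← D.joinPair_circleSetoid_update hv, Setoid.joinPair_eq_self h]

theorem isCompatible_of_update {v : D.Vertex} {c : Fin D.n} (hv : v c = false)
    {κ : Fin D.m → Fin 2} (hκ : D.IsCompatible (Function.update v c true) κ)
    (h : κ (D.edge c 0) = κ (D.edge c 2)) : D.IsCompatible v κ := by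
  have h1 : D.circleSetoid v ≤ Setoid.ker κ :=
    (Setoid.le_joinPair _ _ _).trans ((D.joinPair_circleSetoid_update hv).le.trans
      (Setoid.joinPair_le (s := Setoid.ker κ) (fun e f => hκ e f) h))
  exact fun e f hef => h1 hef

open Classical in
-- Multiplication is pointwise multiplication of functions on colourings, and a colouring after the
-- merge restricts to one before it.
theorem sum_edgeCoeff_merge {v : D.Vertex} {c : Fin D.n} (hv : v c = false)
    (h : ¬ D.circleSetoid v (D.edge c 0) (D.edge c 2)) (l : D.Circle v → Fin 2)
    {κ : Fin D.m → Fin 2} (hκ : D.IsCompatible (Function.update v c true) κ) :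
    (∑ l', if ∀ e, D.label ⟨Function.update v c true, l'⟩ e ≤ κ e then
      D.edgeCoeff c ⟨v, l⟩ ⟨Function.update v c true, l'⟩ else 0)
      = if ∀ e, D.label ⟨v, l⟩ e ≤ κ e then 1 else 0 := by
  have hjoin := D.circleSetoid_of_merge hv h
  set w := Function.update v c true with hw
  have hle : D.circleSetoid v ≤ D.circleSetoid w := hjoin ▸ Setoid.le_joinPair _ _ _
  have h02 : D.circleSetoid w (D.edge c 0) (D.edge c 2) := hjoin ▸ Setoid.joinPair_pair _ _ _
  have hoff : ∀ e, ¬ D.circleSetoid w e (D.edge c 0) →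
      ¬ D.circleSetoid v e (D.edge c 0) ∧ ¬ D.circleSetoid v e (D.edge c 2) := fun e he =>
    ⟨fun h' => he (hle h'), fun h' => he ((D.circleSetoid w).trans' (hle h')
      ((D.circleSetoid w).symm' h02))⟩
  have hon : ∀ e, D.circleSetoid w e (D.edge c 0) →
      D.circleSetoid v e (D.edge c 0) ∨ D.circleSetoid v e (D.edge c 2) := by
    intro e he
    by_contra! hcon
    rw [hjoin] at he
    exact hcon.1 (Setoid.joinPair_rel_of_not he hcon.1 hcon.2)
  -- The label of the only generator in the image; exponents combine by `max` because `x ^ 2 = x`.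
  let L : Fin D.m → Fin 2 := fun e => if D.circleSetoid w e (D.edge c 0) then
    max (D.label ⟨v, l⟩ (D.edge c 0)) (D.label ⟨v, l⟩ (D.edge c 2)) else D.label ⟨v, l⟩ e
  have hL : D.IsCompatible w L := by
    intro e f hef
    by_cases he : D.circleSetoid w e (D.edge c 0)
    · have hf : D.circleSetoid w f (D.edge c 0) :=
        (D.circleSetoid w).trans' ((D.circleSetoid w).symm' hef) he
      simp only [L, he, hf, if_true]
    · have hf : ¬ D.circleSetoid w f (D.edge c 0) := fun hf =>
        he ((D.circleSetoid w).trans' hef hf)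
      simp only [L, he, hf, if_false]
      rw [hjoin] at hef
      exact D.isCompatible_label ⟨v, l⟩ _ _
        (Setoid.joinPair_rel_of_not hef (hoff e he).1 (hoff e he).2)
  have hcoeff : ∀ l', (if ∀ e, D.label ⟨w, l'⟩ e ≤ κ e then
      D.edgeCoeff c ⟨v, l⟩ ⟨w, l'⟩ else 0)
      = if ∀ e, D.label ⟨w, l'⟩ e = L e then
        (if ∀ e, D.label ⟨w, l'⟩ e ≤ κ e then 1 else 0) else 0 := by
    intro l'
    have hiff : (∀ e, D.label ⟨w, l'⟩ e = L e) ↔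
        (∀ e, D.circle v e ≠ D.circle v (D.edge c 0) → D.circle v e ≠ D.circle v (D.edge c 2) →
          D.label ⟨w, l'⟩ e = D.label ⟨v, l⟩ e) ∧
        D.label ⟨w, l'⟩ (D.edge c 0)
          = max (D.label ⟨v, l⟩ (D.edge c 0)) (D.label ⟨v, l⟩ (D.edge c 2)) := by
      simp only [ne_eq, D.circle_eq_iff]
      constructor
      · intro h'
        refine ⟨fun e h0 h2 => ?_, ?_⟩
        · have he : ¬ D.circleSetoid w e (D.edge c 0) := fun he => (hon e he).elim h0 h2
          rw [h' e]
          simp only [L, he, if_false]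
        · rw [h']
          simp only [L, (D.circleSetoid w).refl' (D.edge c 0), if_true]
      · rintro ⟨h1, h2⟩ e
        by_cases he : D.circleSetoid w e (D.edge c 0)
        · simp only [L, he, if_true]
          rw [← h2]
          exact D.isCompatible_label ⟨w, l'⟩ _ _ he
        · simp only [L, he, if_false]
          exact h1 e (hoff e he).1 (hoff e he).2
    have hedge : D.edgeCoeff c ⟨v, l⟩ ⟨w, l'⟩ = if ∀ e, D.label ⟨w, l'⟩ e = L e then 1 else 0 := by
      simp only [hiff]
      rw [PDCode.edgeCoeff]
      simp only [hv, D.circle_eq_iff, h, if_false, mulCoeff, true_and, ← hw]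
      rw [ite_and]
    rw [hedge]
    split_ifs <;> rfl
  rw [Finset.sum_congr rfl fun l' _ => hcoeff l',
    D.sum_ite_forall_eq hL (fun L => if ∀ e, L e ≤ κ e then (1 : ℤ) else 0)]
  have hiff : (∀ e, L e ≤ κ e) ↔ ∀ e, D.label ⟨v, l⟩ e ≤ κ e := by
    constructor
    · intro h' e
      by_cases he : D.circleSetoid w e (D.edge c 0)
      · have h1 := h' e
        simp only [L, he, if_true] at h1
        rcases hon e he with h2 | h2
        · rw [D.isCompatible_label ⟨v, l⟩ _ _ h2]
          exact (le_max_left _ _).trans h1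
        · rw [D.isCompatible_label ⟨v, l⟩ _ _ h2]
          exact (le_max_right _ _).trans h1
      · have h1 := h' e
        simpa only [L, he, if_false] using h1
    · intro h' e
      by_cases he : D.circleSetoid w e (D.edge c 0)
      · simp only [L, he, if_true]
        rw [hκ _ _ he]
        refine max_le (h' _) ?_
        rw [hκ _ _ h02]
        exact h' _
      · simpa only [L, he, if_false] using h' e
  simp only [hiff]

open Classical in
-- The image is expanded over the labels `a`, `b` of the two new circles, and the inner sum is the
-- value of `Δ` computed in `sum_comulCoeff`.
theorem sum_edgeCoeff_split {v : D.Vertex} {c : Fin D.n} (hv : v c = false)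
    (h : D.circleSetoid v (D.edge c 0) (D.edge c 2)) (l : D.Circle v → Fin 2)
    {κ : Fin D.m → Fin 2} (hκ : D.IsCompatible (Function.update v c true) κ) :
    (∑ l', if ∀ e, D.label ⟨Function.update v c true, l'⟩ e ≤ κ e then
      D.edgeCoeff c ⟨v, l⟩ ⟨Function.update v c true, l'⟩ else 0)
      = if κ (D.edge c 0) = κ (D.edge c 2) ∧ ∀ e, D.label ⟨v, l⟩ e ≤ κ e then
        (if κ (D.edge c 0) = 1 then 1 else -1) else 0 := by
  have hjoin := D.circleSetoid_of_split hv h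
  have hnot := (D.circleSetoid_iff_not_update hv).1 h
  have hcompat := D.isCompatible_of_update hv hκ
  set w := Function.update v c true with hw
  have hle : D.circleSetoid w ≤ D.circleSetoid v := hjoin ▸ Setoid.le_joinPair _ _ _
  have hoff : ∀ e, ¬ D.circleSetoid v e (D.edge c 0) →
      ¬ D.circleSetoid w e (D.edge c 0) ∧ ¬ D.circleSetoid w e (D.edge c 2) := fun e he =>
    ⟨fun h' => he (hle h'), fun h' => he ((D.circleSetoid v).trans' (hle h')
      ((D.circleSetoid v).symm' h))⟩
  have hon : ∀ e, D.circleSetoid v e (D.edge c 0) →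
      D.circleSetoid w e (D.edge c 0) ∨ D.circleSetoid w e (D.edge c 2) := by
    intro e he
    by_contra! hcon
    rw [hjoin] at he
    exact hcon.1 (Setoid.joinPair_rel_of_not he hcon.1 hcon.2)
  have hdisj : ∀ e, D.circleSetoid w e (D.edge c 2) → ¬ D.circleSetoid w e (D.edge c 0) :=
    fun e h2 h0 => hnot ((D.circleSetoid w).trans' ((D.circleSetoid w).symm' h0) h2)
  let L : Fin 2 → Fin 2 → Fin D.m → Fin 2 := fun a b e =>
    if D.circleSetoid w e (D.edge c 0) then a
    else if D.circleSetoid w e (D.edge c 2) then b else D.label ⟨v, l⟩ e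
  have hL : ∀ a b, D.IsCompatible w (L a b) := by
    intro a b e f hef
    have h0 : D.circleSetoid w e (D.edge c 0) ↔ D.circleSetoid w f (D.edge c 0) :=
      ⟨fun h' => (D.circleSetoid w).trans' ((D.circleSetoid w).symm' hef) h',
        fun h' => (D.circleSetoid w).trans' hef h'⟩
    have h2 : D.circleSetoid w e (D.edge c 2) ↔ D.circleSetoid w f (D.edge c 2) :=
      ⟨fun h' => (D.circleSetoid w).trans' ((D.circleSetoid w).symm' hef) h',
        fun h' => (D.circleSetoid w).trans' hef h'⟩
    simp only [L, h0, h2, D.isCompatible_label ⟨v, l⟩ _ _ (hle hef)]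
  have hcoeff : ∀ l', (if ∀ e, D.label ⟨w, l'⟩ e ≤ κ e then
      D.edgeCoeff c ⟨v, l⟩ ⟨w, l'⟩ else 0)
      = ∑ a, ∑ b, if ∀ e, D.label ⟨w, l'⟩ e = L a b e then
        (if ∀ e, D.label ⟨w, l'⟩ e ≤ κ e then
          comulCoeff (D.label ⟨v, l⟩ (D.edge c 0)) a b else 0) else 0 := by
    intro l'
    have hiff : ∀ a b, (∀ e, D.label ⟨w, l'⟩ e = L a b e) ↔
        (∀ e, D.circle v e ≠ D.circle v (D.edge c 0) → D.circle v e ≠ D.circle v (D.edge c 2) →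
          D.label ⟨w, l'⟩ e = D.label ⟨v, l⟩ e) ∧
        b = D.label ⟨w, l'⟩ (D.edge c 2) ∧ a = D.label ⟨w, l'⟩ (D.edge c 0) := by
      intro a b
      simp only [ne_eq, D.circle_eq_iff]
      constructor
      · intro h'
        refine ⟨fun e h0 _ => ?_, ?_, ?_⟩
        · rw [h' e]
          simp only [L, hoff e h0, if_false]
        · rw [h']
          simp only [L, hdisj _ ((D.circleSetoid w).refl' (D.edge c 2)),
            (D.circleSetoid w).refl' (D.edge c 2), if_true, if_false]
        · rw [h']
          simp only [L, (D.circleSetoid w).refl' (D.edge c 0), if_true]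
      · rintro ⟨h1, rfl, rfl⟩ e
        by_cases h0 : D.circleSetoid w e (D.edge c 0)
        · simp only [L, h0, if_true]
          exact D.isCompatible_label ⟨w, l'⟩ _ _ h0
        · by_cases h2 : D.circleSetoid w e (D.edge c 2)
          · simp only [L, h0, h2, if_true, if_false]
            exact D.isCompatible_label ⟨w, l'⟩ _ _ h2
          · simp only [L, h0, h2, if_false]
            have he : ¬ D.circleSetoid v e (D.edge c 0) := fun he => (hon e he).elim h0 h2
            exact h1 e he fun h' => he ((D.circleSetoid v).trans' h'
              ((D.circleSetoid v).symm' h))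
    have hedge : D.edgeCoeff c ⟨v, l⟩ ⟨w, l'⟩ =
        if (∀ e, D.circle v e ≠ D.circle v (D.edge c 0) →
          D.circle v e ≠ D.circle v (D.edge c 2) → D.label ⟨w, l'⟩ e = D.label ⟨v, l⟩ e) then
        comulCoeff (D.label ⟨v, l⟩ (D.edge c 0)) (D.label ⟨w, l'⟩ (D.edge c 0))
          (D.label ⟨w, l'⟩ (D.edge c 2)) else 0 := by
      rw [PDCode.edgeCoeff]
      simp only [hv, D.circle_eq_iff, h, if_true, true_and, ← hw]
    rw [hedge]
    simp only [hiff, ite_and]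
    split_ifs <;> simp
  rw [Finset.sum_congr rfl fun l' _ => hcoeff l', Finset.sum_comm]
  have hsum : ∀ a b, (∑ l', if ∀ e, D.label ⟨w, l'⟩ e = L a b e then
        (if ∀ e, D.label ⟨w, l'⟩ e ≤ κ e then
          comulCoeff (D.label ⟨v, l⟩ (D.edge c 0)) a b else 0) else 0)
      = if ∀ e, L a b e ≤ κ e then comulCoeff (D.label ⟨v, l⟩ (D.edge c 0)) a b else 0 :=
    fun a b => D.sum_ite_forall_eq (hL a b) (fun L => if ∀ e, L e ≤ κ e then
      comulCoeff (D.label ⟨v, l⟩ (D.edge c 0)) a b else 0)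
  rw [Finset.sum_congr rfl fun a _ => (Finset.sum_comm.trans
    (Finset.sum_congr rfl fun b _ => hsum a b))]
  have hiff : ∀ a b, (∀ e, L a b e ≤ κ e) ↔
      (∀ e, ¬ D.circleSetoid v e (D.edge c 0) → D.label ⟨v, l⟩ e ≤ κ e) ∧
        a ≤ κ (D.edge c 0) ∧ b ≤ κ (D.edge c 2) := by
    intro a b
    constructor
    · intro h'
      refine ⟨fun e he => ?_, ?_, ?_⟩
      · have := h' e
        simpa only [L, hoff e he, if_false] using this
      · have := h' (D.edge c 0)
        simpa only [L, (D.circleSetoid w).refl' (D.edge c 0), if_true] using this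
      · have := h' (D.edge c 2)
        simpa only [L, hdisj _ ((D.circleSetoid w).refl' (D.edge c 2)),
            (D.circleSetoid w).refl' (D.edge c 2), if_true, if_false] using this
    · rintro ⟨h1, ha, hb⟩ e
      by_cases h0 : D.circleSetoid w e (D.edge c 0)
      · simpa only [L, h0, if_true, hκ _ _ h0] using ha
      · by_cases h2 : D.circleSetoid w e (D.edge c 2)
        · simpa only [L, h0, h2, if_true, if_false, hκ _ _ h2] using hb
        · have he : ¬ D.circleSetoid v e (D.edge c 0) := fun he => (hon e he).elim h0 h2
          simpa only [L, h0, h2, if_false] using h1 e he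
  have hiff2 : (κ (D.edge c 0) = κ (D.edge c 2) ∧ ∀ e, D.label ⟨v, l⟩ e ≤ κ e) ↔
      (∀ e, ¬ D.circleSetoid v e (D.edge c 0) → D.label ⟨v, l⟩ e ≤ κ e) ∧
        κ (D.edge c 0) = κ (D.edge c 2) ∧ D.label ⟨v, l⟩ (D.edge c 0) ≤ κ (D.edge c 0) := by
    constructor
    · rintro ⟨h1, h2⟩
      exact ⟨fun e _ => h2 e, h1, h2 _⟩
    · rintro ⟨h1, h2, h3⟩
      refine ⟨h2, fun e => ?_⟩
      by_cases he : D.circleSetoid v e (D.edge c 0)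
      · rw [D.isCompatible_label ⟨v, l⟩ _ _ he, hcompat h2 _ _ he]
        exact h3
      · exact h1 e he
  simp only [hiff, hiff2]
  rw [ite_and (P := ∀ e, ¬ D.circleSetoid v e (D.edge c 0) → D.label ⟨v, l⟩ e ≤ κ e),
    ← PDCode.sum_comulCoeff]
  split_ifs with hP
  · simp only [eq_true hP, true_and]
  · simp only [eq_false hP, false_and, if_false, Finset.sum_const_zero]

open Classical in
theorem sum_edgeCoeff (c : Fin D.n) (σ : D.Generator) (w : D.Vertex) {κ : Fin D.m → Fin 2}
    (hκ : D.IsCompatible w κ) :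
    (∑ l', if ∀ e, D.label ⟨w, l'⟩ e ≤ κ e then D.edgeCoeff c σ ⟨w, l'⟩ else 0)
      = if σ.1 c = false ∧ w = Function.update σ.1 c true ∧ κ (D.edge c 0) = κ (D.edge c 2) ∧
          ∀ e, D.label σ e ≤ κ e then D.edgeWeight σ.1 c (κ (D.edge c 0)) else 0 := by
  obtain ⟨v, l⟩ := σ
  by_cases hv : v c = false
  · by_cases hw : w = Function.update v c true
    · subst hw
      simp only [hv, true_and]
      by_cases h : D.circleSetoid v (D.edge c 0) (D.edge c 2)
      · rw [D.sum_edgeCoeff_split hv h l hκ]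
        simp only [PDCode.edgeWeight, D.circle_eq_iff, h, if_true]
      · rw [D.sum_edgeCoeff_merge hv h l hκ]
        have h02 : κ (D.edge c 0) = κ (D.edge c 2) := hκ _ _ (by
          by_contra h'
          exact h ((D.circleSetoid_iff_not_update hv).2 h'))
        simp only [PDCode.edgeWeight, D.circle_eq_iff, h, if_false, h02, true_and]
    · simp [hw, PDCode.edgeCoeff]
  · simp [hv, PDCode.edgeCoeff]

end KnotDiagram

/-! ### Idempotent coordinates, conjugation and the Seifert cocycle -/

namespace PDCode

variable (D : PDCode) (K : Type*) [CommRing K]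

open Classical in
/-- The coordinate of a cochain with respect to the idempotents that correspond to the colouring
`κ` of the circles of `v`: the value at `κ` of the polynomial function on the colourings of the
circles that the cochain defines. -/
def evalAt (v : D.Vertex) (κ : Fin D.m → Fin 2) : D.Cochains K →ₗ[K] K where
  toFun f := ∑ l : D.Circle v → Fin 2, if ∀ e, D.label ⟨v, l⟩ e ≤ κ e then f ⟨v, l⟩ else 0
  map_add' f g := by
    rw [← Finset.sum_add_distrib]
    exact Finset.sum_congr rfl fun l _ => by split_ifs <;> simp
  map_smul' a f := by
    rw [RingHom.id_apply, smul_eq_mul, Finset.mul_sum]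
    exact Finset.sum_congr rfl fun l _ => by split_ifs <;> simp

open Classical in
theorem evalAt_apply (v : D.Vertex) (κ : Fin D.m → Fin 2) (f : D.Cochains K) :
    D.evalAt K v κ f
      = ∑ l : D.Circle v → Fin 2, if ∀ e, D.label ⟨v, l⟩ e ≤ κ e then f ⟨v, l⟩ else 0 := rfl

theorem label_le_label_iff {v : D.Vertex} {l l' : D.Circle v → Fin 2} :
    (∀ e, D.label ⟨v, l⟩ e ≤ D.label ⟨v, l'⟩ e) ↔ l ≤ l' := by
  constructor
  · intro h C
    induction C using Quotient.inductionOn with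
    | h e => exact h e
  · exact fun h e => h _

variable {K}

/-- Evaluation is unitriangular for the order on labels, so induction on the label works over any
ring. -/
theorem eq_zero_of_evalAt_eq_zero {f : D.Cochains K}
    (h : ∀ v κ, D.IsCompatible v κ → D.evalAt K v κ f = 0) : f = 0 := by
  classical
  ext ⟨v, l⟩
  induction l using WellFoundedLT.induction with
  | ind l ih =>
    have h1 := h v (D.label ⟨v, l⟩) (D.isCompatible_label ⟨v, l⟩)
    rw [evalAt_apply, Finset.sum_eq_single l] at h1
    · simpa using h1
    · intro l' _ hl'
      split_ifs with h2
      · exact ih l' (lt_of_le_of_ne (D.label_le_label_iff.1 h2) hl')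
      · rfl
    · simp

theorem eq_of_evalAt_eq {f g : D.Cochains K}
    (h : ∀ v κ, D.IsCompatible v κ → D.evalAt K v κ f = D.evalAt K v κ g) : f = g :=
  sub_eq_zero.1 (D.eq_zero_of_evalAt_eq_zero fun v κ hκ => by
    rw [map_sub, h v κ hκ, sub_self])

theorem apply_out_circle {v : D.Vertex} {κ : Fin D.m → Fin 2} (hκ : D.IsCompatible v κ)
    (e : Fin D.m) : κ (D.circle v e).out = κ e :=
  hκ _ _ (Quotient.mk_out (s := D.circleSetoid v) e)

theorem forall_label_le_iff {v : D.Vertex} {κ : Fin D.m → Fin 2} (hκ : D.IsCompatible v κ)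
    (l : D.Circle v → Fin 2) :
    (∀ e, D.label ⟨v, l⟩ e ≤ κ e) ↔ ∀ C ∈ Finset.univ, l C ≤ κ (Quotient.out C) := by
  constructor
  · intro h C _
    have := h C.out
    rwa [label, circle, Quotient.out_eq] at this
  · intro h e
    have := h (D.circle v e) (Finset.mem_univ _)
    rwa [D.apply_out_circle hκ] at this

open Classical in
theorem sum_prod_label_le {v : D.Vertex} {κ : Fin D.m → Fin 2} (hκ : D.IsCompatible v κ)
    (g : D.Circle v → Fin 2 → K) :
    (∑ l : D.Circle v → Fin 2, if ∀ e, D.label ⟨v, l⟩ e ≤ κ e then ∏ C, g C (l C) else 0)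
      = ∏ C, ∑ a, if a ≤ κ C.out then g C a else 0 := by
  rw [Finset.prod_univ_sum, Fintype.piFinset_univ]
  refine Finset.sum_congr rfl fun l _ => ?_
  rw [Finset.prod_ite_zero]
  have hiff := D.forall_label_le_iff hκ l
  by_cases h : ∀ e, D.label ⟨v, l⟩ e ≤ κ e
  · rw [if_pos h, if_pos (hiff.1 h)]
  · rw [if_neg h, if_neg fun h' => h (hiff.2 h')]

variable (K)

theorem differential_apply (f : D.Cochains K) (τ : D.Generator) :
    D.differential K f τ
      = ∑ σ, ((∑ c, D.edgeSign σ.1 c * D.edgeCoeff c σ τ : ℤ) : K) * f σ := rfl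

theorem differential_intCast (f : D.Cochains ℤ) :
    D.differential K (fun σ => (f σ : K)) = fun τ => ((D.differential ℤ f τ : ℤ) : K) := by
  ext τ
  simp only [differential_apply]
  push_cast
  rfl

open Classical in
theorem xAction_apply (b : Fin D.m) (f : D.Cochains K) (τ : D.Generator) :
    D.xAction K b f τ = ∑ σ : D.Generator,
      (if τ = ⟨σ.1, Function.update σ.2 (D.circle σ.1 b) 1⟩ then (1 : K) else 0) * f σ := rfl

theorem xAction_intCast (b : Fin D.m) (f : D.Cochains ℤ) :
    D.xAction K b (fun σ => (f σ : K)) = fun τ => ((D.xAction ℤ b f τ : ℤ) : K) := by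
  ext τ
  simp only [xAction_apply]
  push_cast
  rfl

theorem evalAt_intCast (v : D.Vertex) (κ : Fin D.m → Fin 2) (f : D.Cochains ℤ) :
    D.evalAt K v κ (fun σ => (f σ : K)) = ((D.evalAt ℤ v κ f : ℤ) : K) := by
  simp only [evalAt_apply]
  push_cast
  rfl

/-- As a function on colourings, `x` at the basepoint has value `κ b`, so it projects to the
idempotents with colour `1` there. -/
theorem evalAt_xAction {v : D.Vertex} {κ : Fin D.m → Fin 2} (hκ : D.IsCompatible v κ)
    (b : Fin D.m) (f : D.Cochains K) :
    D.evalAt K v κ (D.xAction K b f) = if κ b = 1 then D.evalAt K v κ f else 0 := by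
  classical
  have hx : ∀ l', D.xAction K b f ⟨v, l'⟩
      = ∑ l, if l' = Function.update l (D.circle v b) 1 then f ⟨v, l⟩ else 0 := by
    intro l'
    rw [xAction_apply, Fintype.sum_sigma, Finset.sum_eq_single v]
    · exact Finset.sum_congr rfl fun l _ => by simp
    · intro u _ hu
      refine Finset.sum_eq_zero fun l _ => ?_
      rw [if_neg, zero_mul]
      intro h
      exact hu (congrArg Sigma.fst h).symm
    · simp
  have hiff : ∀ l, (∀ e, D.label ⟨v, Function.update l (D.circle v b) 1⟩ e ≤ κ e) ↔
      κ b = 1 ∧ ∀ e, D.label ⟨v, l⟩ e ≤ κ e := by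
    intro l
    simp only [label]
    constructor
    · intro h
      have hb : κ b = 1 := by
        have := h b
        rw [Function.update_self] at this
        omega
      refine ⟨hb, fun e => ?_⟩
      by_cases he : D.circle v e = D.circle v b
      · rw [hκ e b (D.circle_eq_iff.1 he), hb]
        omega
      · have := h e
        rwa [Function.update_of_ne he] at this
    · rintro ⟨hb, h⟩ e
      by_cases he : D.circle v e = D.circle v b
      · rw [hκ e b (D.circle_eq_iff.1 he), hb]
        omega
      · rw [Function.update_of_ne he]
        exact h e
  simp only [evalAt_apply, hx]
  have h1 : ∀ l' : D.Circle v → Fin 2, (if ∀ e, D.label ⟨v, l'⟩ e ≤ κ e then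
      ∑ l, (if l' = Function.update l (D.circle v b) 1 then f ⟨v, l⟩ else 0) else 0)
      = ∑ l, if l' = Function.update l (D.circle v b) 1 then
        (if ∀ e, D.label ⟨v, l'⟩ e ≤ κ e then f ⟨v, l⟩ else 0) else 0 := by
    intro l'
    split_ifs <;> simp
  rw [Finset.sum_congr rfl fun l' _ => h1 l', Finset.sum_comm]
  simp only [Finset.sum_ite_eq', Finset.mem_univ, if_true, hiff, ite_and]
  split_ifs <;> simp

variable {K}

/-- Replacing `1` by `x` costs two quantum degrees and `x * x = x` costs none; hence `x F_{q+1}`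
lives in degrees at least `q - 1`. -/
theorem exists_of_xAction_ne_zero {b : Fin D.m} {f : D.Cochains K} {τ : D.Generator}
    (h : D.xAction K b f τ ≠ 0) : ∃ σ, f σ ≠ 0 ∧ D.homDegree τ = D.homDegree σ ∧
      D.qDegree σ - 2 ≤ D.qDegree τ := by
  classical
  rw [xAction_apply] at h
  obtain ⟨σ, -, hσ⟩ := Finset.exists_ne_zero_of_sum_ne_zero h
  have hτ : τ = ⟨σ.1, Function.update σ.2 (D.circle σ.1 b) 1⟩ := by
    by_contra hτ
    simp [hτ] at hσ
  refine ⟨σ, right_ne_zero_of_mul hσ, by rw [hτ]; rfl, ?_⟩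
  subst hτ
  simp only [qDegree]
  have hsum : ∑ C : D.Circle σ.1, (1 - 2 * ((σ.2 C : ℕ) : ℤ)) - 2
      ≤ ∑ C, (1 - 2 * ((Function.update σ.2 (D.circle σ.1 b) 1 C : ℕ) : ℤ)) := by
    rw [← Finset.add_sum_erase _ _ (Finset.mem_univ (D.circle σ.1 b)),
      ← Finset.add_sum_erase _
        (fun C => 1 - 2 * ((Function.update σ.2 (D.circle σ.1 b) 1 C : ℕ) : ℤ))
        (Finset.mem_univ (D.circle σ.1 b))]
    have : ∀ C ∈ Finset.univ.erase (D.circle σ.1 b),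
        1 - 2 * ((Function.update σ.2 (D.circle σ.1 b) 1 C : ℕ) : ℤ)
          = 1 - 2 * ((σ.2 C : ℕ) : ℤ) := by
      intro C hC
      rw [Function.update_of_ne (Finset.ne_of_mem_erase hC)]
    rw [Finset.sum_congr rfl this, Function.update_self]
    simp
    omega
  linarith

/-! ## Conjugation -/

/-- The coefficient of `x ^ b` in the image of `x ^ a` under the involution `x ↦ 1 - x`. -/
def conjCoeff (a b : Fin 2) : ℤ :=
  if b ≤ a then (if b = 1 then -1 else 1) else 0

/-- The sign of the conjugation at a vertex. -/
def conjSign (v : D.Vertex) : ℤ := (-1) ^ ((Nat.card (D.Circle v) + D.height v + D.nPlus) / 2)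

variable (K)

open Classical in
/-- The involution `x ↦ 1 - x` on all tensor factors, with signs that make it a chain map. -/
def conjugation : D.Cochains K →ₗ[K] D.Cochains K where
  toFun f τ := D.conjSign τ.1 *
    ∑ l : D.Circle τ.1 → Fin 2, ((∏ C, conjCoeff (l C) (τ.2 C) : ℤ) : K) * f ⟨τ.1, l⟩
  map_add' f g := by
    ext τ
    simp only [Pi.add_apply, mul_add, Finset.sum_add_distrib]
  map_smul' a f := by
    ext τ
    simp only [Pi.smul_apply, smul_eq_mul, RingHom.id_apply, Finset.mul_sum]
    exact Finset.sum_congr rfl fun l _ => by ring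

open Classical in
theorem conjugation_apply (f : D.Cochains K) (τ : D.Generator) :
    D.conjugation K f τ = D.conjSign τ.1 *
      ∑ l : D.Circle τ.1 → Fin 2, ((∏ C, conjCoeff (l C) (τ.2 C) : ℤ) : K) * f ⟨τ.1, l⟩ := rfl

theorem isCompatible_sub {v : D.Vertex} {κ : Fin D.m → Fin 2} (hκ : D.IsCompatible v κ) :
    D.IsCompatible v fun e => 1 - κ e := fun e f h =>
  congrArg (1 - ·) (hκ e f h)

theorem sum_conjCoeff (a k : Fin 2) :
    (∑ b : Fin 2, if b ≤ k then ((conjCoeff a b : ℤ) : K) else 0)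
      = if a ≤ 1 - k then 1 else 0 := by
  rw [Fin.sum_univ_two]
  fin_cases a <;> fin_cases k <;> simp [conjCoeff]

/-- The substitution `x ↦ 1 - x` exchanges the two points at which `x` is evaluated. -/
theorem evalAt_conjugation {v : D.Vertex} {κ : Fin D.m → Fin 2} (hκ : D.IsCompatible v κ)
    (f : D.Cochains K) :
    D.evalAt K v κ (D.conjugation K f) = D.conjSign v * D.evalAt K v (fun e => 1 - κ e) f := by
  classical
  simp only [evalAt_apply, conjugation_apply]
  have h1 : ∀ l' : D.Circle v → Fin 2, (if ∀ e, D.label ⟨v, l'⟩ e ≤ κ e then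
      (D.conjSign v : K) * ∑ l : D.Circle v → Fin 2,
        ((∏ C, conjCoeff (l C) (l' C) : ℤ) : K) * f ⟨v, l⟩ else 0)
      = D.conjSign v * ∑ l, f ⟨v, l⟩ * if ∀ e, D.label ⟨v, l'⟩ e ≤ κ e then
        ∏ C, ((conjCoeff (l C) (l' C) : ℤ) : K) else 0 := by
    intro l'
    split_ifs
    · push_cast
      simp only [mul_comm]
    · simp
  rw [Finset.sum_congr rfl fun l' _ => h1 l', ← Finset.mul_sum, Finset.sum_comm]
  congr 1
  refine Finset.sum_congr rfl fun l _ => ?_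
  rw [← Finset.mul_sum, D.sum_prod_label_le hκ (fun C a => ((conjCoeff (l C) a : ℤ) : K))]
  simp only [sum_conjCoeff]
  rw [Finset.prod_ite_zero]
  rw [Finset.prod_const_one, mul_ite, mul_one, mul_zero]
  have hiff := D.forall_label_le_iff (D.isCompatible_sub hκ) l
  by_cases h : ∀ e, D.label ⟨v, l⟩ e ≤ 1 - κ e
  · rw [if_pos h, if_pos (hiff.1 h)]
  · rw [if_neg h, if_neg fun h' => h (hiff.2 h')]

theorem qDegree_eq (σ : D.Generator) :
    D.qDegree σ = ((Nat.card (D.Circle σ.1) + D.height σ.1 + D.nPlus : ℕ) : ℤ)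
      - 2 * ((∑ C, (σ.2 C : ℕ) : ℕ) : ℤ) - 2 * D.nMinus := by
  simp only [qDegree, Finset.sum_sub_distrib, ← Finset.mul_sum]
  simp
  ring

theorem conjCoeff_prod_eq_zero {v : D.Vertex} {l l' : D.Circle v → Fin 2} (h : ¬ l' ≤ l) :
    ∏ C, conjCoeff (l C) (l' C) = 0 := by
  obtain ⟨C, hC⟩ := not_forall.1 h
  exact Finset.prod_eq_zero (Finset.mem_univ C) (if_neg hC)

theorem conjCoeff_prod_self {v : D.Vertex} (l : D.Circle v → Fin 2) :
    ∏ C, conjCoeff (l C) (l C) = (-1) ^ (∑ C, (l C : ℕ)) := by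
  rw [← Finset.prod_pow_eq_pow_sum]
  refine Finset.prod_congr rfl fun C _ => ?_
  generalize l C = a
  fin_cases a <;> simp [conjCoeff]

theorem qDegree_lt_of_lt {v : D.Vertex} {l l' : D.Circle v → Fin 2} (h : l' < l) :
    D.qDegree ⟨v, l⟩ < D.qDegree ⟨v, l'⟩ := by
  have : (∑ C, (l' C : ℕ)) < ∑ C, (l C : ℕ) := by
    obtain ⟨hle, C, hC⟩ := Pi.lt_def.1 h
    exact Finset.sum_lt_sum (fun C _ => hle C) ⟨C, Finset.mem_univ _, hC⟩
  rw [qDegree_eq, qDegree_eq]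
  dsimp only
  omega

/-- The leading term of the conjugation. -/
theorem conjugation_apply_of_forall_lt {f : D.Cochains K} {τ : D.Generator}
    (h : ∀ σ, D.qDegree σ < D.qDegree τ → f σ = 0) :
    D.conjugation K f τ
      = ((D.conjSign τ.1 * (-1) ^ (∑ C, (τ.2 C : ℕ)) : ℤ) : K) * f τ := by
  obtain ⟨v, l'⟩ := τ
  rw [conjugation_apply, Finset.sum_eq_single l', conjCoeff_prod_self, ← mul_assoc]
  · push_cast
    rfl
  · intro l _ hl
    by_cases hle : l' ≤ l
    · rw [h ⟨v, l⟩ (D.qDegree_lt_of_lt (lt_of_le_of_ne hle hl.symm)), mul_zero]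
    · rw [D.conjCoeff_prod_eq_zero hle]
      simp
  · simp

/-! ## The cocycle of the oriented resolution -/

/-- The coefficient of `x ^ a` in the idempotent `x` (for `k = 1`) or `1 - x` (for `k = 0`). -/
def idempotentCoeff (k a : Fin 2) : ℤ :=
  if k = 1 then (if a = 1 then 1 else 0) else (if a = 1 then -1 else 1)

theorem sum_idempotentCoeff (k k' : Fin 2) :
    (∑ a : Fin 2, if a ≤ k' then ((idempotentCoeff k a : ℤ) : K) else 0)
      = if k' = k then 1 else 0 := by
  rw [Fin.sum_univ_two]
  fin_cases k <;> fin_cases k' <;> simp [idempotentCoeff]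

open Classical in
/-- The tensor product of the idempotents that `κ` assigns to the circles of the oriented
resolution. -/
def seifertCochain (κ : Fin D.m → Fin 2) : D.Cochains K := fun σ =>
  if σ.1 = D.seifertVertex then ∏ C : D.Circle σ.1, ((idempotentCoeff (κ C.out) (σ.2 C) : ℤ) : K)
  else 0

open Classical in
-- An idempotent is the indicator function of its own colouring.
theorem evalAt_seifertCochain {v : D.Vertex} {κ κ' : Fin D.m → Fin 2}
    (hκ : D.IsCompatible D.seifertVertex κ) (hκ' : D.IsCompatible v κ') :
    D.evalAt K v κ' (D.seifertCochain K κ) = if v = D.seifertVertex ∧ κ' = κ then 1 else 0 := by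
  rw [evalAt_apply]
  by_cases hv : v = D.seifertVertex
  · subst hv
    simp only [seifertCochain, if_true, true_and]
    rw [D.sum_prod_label_le hκ' (fun C a => ((idempotentCoeff (κ C.out) a : ℤ) : K))]
    simp only [sum_idempotentCoeff]
    rw [Finset.prod_ite_zero, Finset.prod_const_one]
    have : (∀ C ∈ (Finset.univ : Finset (D.Circle D.seifertVertex)),
        κ' (Quotient.out C) = κ (Quotient.out C)) ↔ κ' = κ := by
      constructor
      · intro h
        ext1 e
        have h1 := h (D.circle D.seifertVertex e) (Finset.mem_univ _)
        rwa [D.apply_out_circle hκ, D.apply_out_circle hκ'] at h1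
      · exact fun h C _ => by rw [h]
    simp only [this]
  · simp [seifertCochain, hv]

theorem IsSeifertColouring.isCompatible {κ : Fin D.m → Fin 2} (hκ : D.IsSeifertColouring κ) :
    D.IsCompatible D.seifertVertex κ := by
  have : D.circleSetoid D.seifertVertex ≤ Setoid.ker κ := by
    refine circleSetoid_le (fun c hc => ?_) (fun c hc => ?_) <;>
    · have h1 := hκ.eq_one c
      have h3 := hκ.eq_three c
      cases hp : D.positive c <;> simp [seifertVertex, hp] at hc
      simp only [hp, if_true, if_false, Bool.false_eq_true] at h1 h3
      exact ⟨by simp [Setoid.ker_def, h1], by simp [Setoid.ker_def, h3]⟩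
  exact fun e f h => this h

theorem xAction_seifertCochain {κ : Fin D.m → Fin 2} (hκ : D.IsSeifertColouring κ) {b : Fin D.m}
    (hb : κ b = 1) : D.xAction K b (D.seifertCochain K κ) = D.seifertCochain K κ := by
  refine D.eq_of_evalAt_eq fun v κ' hκ' => ?_
  rw [D.evalAt_xAction K hκ', D.evalAt_seifertCochain K hκ.isCompatible hκ']
  by_cases h : κ' = κ
  · simp [h, hb]
  · simp [h]

end PDCode

/-! ### The differential in idempotent coordinates and its compatibility with conjugation -/

namespace KnotDiagram

variable (D : KnotDiagram) (K : Type*) [CommRing K]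

open Classical in
-- Each edge map is diagonal: a colouring receives only from itself, and only along crossings where
-- its colours agree.
theorem evalAt_differential {w : D.Vertex} {κ : Fin D.m → Fin 2} (hκ : D.IsCompatible w κ)
    (f : D.Cochains K) :
    D.evalAt K w κ (D.differential K f) = ∑ c, ∑ v,
      if v c = false ∧ w = Function.update v c true ∧ κ (D.edge c 0) = κ (D.edge c 2) then
        ((D.edgeSign v c * D.edgeWeight v c (κ (D.edge c 0)) : ℤ) : K) * D.evalAt K v κ f
      else 0 := by
  have h1 : ∀ l', (if ∀ e, D.label ⟨w, l'⟩ e ≤ κ e then D.differential K f ⟨w, l'⟩ else 0)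
      = ∑ c, ∑ σ, (D.edgeSign σ.1 c : K) * f σ * ((if ∀ e, D.label ⟨w, l'⟩ e ≤ κ e then
        D.edgeCoeff c σ ⟨w, l'⟩ else 0 : ℤ) : K) := by
    intro l'
    rw [PDCode.differential_apply]
    split_ifs
    · push_cast
      rw [Finset.sum_comm]
      simp only [Finset.sum_mul]
      exact Finset.sum_congr rfl fun _ _ => Finset.sum_congr rfl fun _ _ => by ring
    · simp
  rw [PDCode.evalAt_apply, Finset.sum_congr rfl fun l' _ => h1 l', Finset.sum_comm]
  refine Finset.sum_congr rfl fun c _ => ?_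
  rw [Finset.sum_comm, Fintype.sum_sigma]
  refine Finset.sum_congr rfl fun v _ => ?_
  have h2 : ∀ l : D.Circle v → Fin 2, (∑ l', (D.edgeSign v c : K) * f ⟨v, l⟩ *
      ((if ∀ e, D.label ⟨w, l'⟩ e ≤ κ e then D.edgeCoeff c ⟨v, l⟩ ⟨w, l'⟩ else 0 : ℤ) : K))
      = (D.edgeSign v c : K) * f ⟨v, l⟩ * ((if v c = false ∧ w = Function.update v c true ∧
          κ (D.edge c 0) = κ (D.edge c 2) ∧ ∀ e, D.label ⟨v, l⟩ e ≤ κ e then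
          D.edgeWeight v c (κ (D.edge c 0)) else 0 : ℤ) : K) := by
    intro l
    rw [← Finset.mul_sum, ← Int.cast_sum, D.sum_edgeCoeff c ⟨v, l⟩ w hκ]
  refine (Finset.sum_congr rfl fun l _ => h2 l).trans ?_
  by_cases hP : v c = false ∧ w = Function.update v c true ∧ κ (D.edge c 0) = κ (D.edge c 2)
  · rw [if_pos hP, PDCode.evalAt_apply, Finset.mul_sum]
    refine Finset.sum_congr rfl fun l _ => ?_
    obtain ⟨h3, h4, h5⟩ := hP
    simp only [eq_true h3, eq_true h4, eq_true h5, true_and]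
    split_ifs
    · push_cast
      ring
    · simp
  · rw [if_neg hP]
    refine Finset.sum_eq_zero fun l _ => ?_
    rw [if_neg fun h => hP ⟨h.1, h.2.1, h.2.2.1⟩, Int.cast_zero, mul_zero]

/-- A split raises circles plus height by two, so `conjSign` flips, as does the weight under `k ↦ 1
- k`. A merge preserves both. -/
theorem conjSign_mul_edgeWeight {v : D.Vertex} {c : Fin D.n} (hv : v c = false) (k : Fin 2) :
    D.edgeWeight v c k * D.conjSign v
      = D.conjSign (Function.update v c true) * D.edgeWeight v c (1 - k) := by
  simp only [PDCode.edgeWeight, PDCode.conjSign, D.height_update hv]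
  by_cases h : D.circleSetoid v (D.edge c 0) (D.edge c 2)
  · have h1 : Nat.card (D.Circle (Function.update v c true)) = Nat.card (D.Circle v) + 1 := by
      have := Setoid.card_quotient_joinPair ((D.circleSetoid_iff_not_update hv).1 h)
      rwa [← D.circleSetoid_of_split hv h] at this
    rw [h1, show Nat.card (D.Circle v) + 1 + (D.height v + 1) + D.nPlus
      = (Nat.card (D.Circle v) + D.height v + D.nPlus) + 2 by ring,
      Nat.add_div_right _ (by norm_num), pow_succ]
    simp only [D.circle_eq_iff.2 h, if_true]
    fin_cases k <;> simp
  · have h1 : Nat.card (D.Circle v) = Nat.card (D.Circle (Function.update v c true)) + 1 := by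
      have := Setoid.card_quotient_joinPair h
      rwa [← D.circleSetoid_of_merge hv h] at this
    rw [h1, show Nat.card (D.Circle (Function.update v c true)) + 1 + D.height v + D.nPlus
      = Nat.card (D.Circle (Function.update v c true)) + (D.height v + 1) + D.nPlus by ring]
    simp only [D.circle_eq_iff.not.2 h, if_false, mul_one, one_mul]

theorem differential_conjugation (f : D.Cochains K) :
    D.differential K (D.conjugation K f) = D.conjugation K (D.differential K f) := by
  classical
  refine D.eq_of_evalAt_eq fun w κ hκ => ?_
  rw [D.evalAt_conjugation K hκ, D.evalAt_differential K hκ,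
    D.evalAt_differential K (D.isCompatible_sub hκ), Finset.mul_sum]
  refine Finset.sum_congr rfl fun c _ => ?_
  rw [Finset.mul_sum]
  refine Finset.sum_congr rfl fun v _ => ?_
  simp only [sub_right_inj]
  split_ifs with h
  · obtain ⟨hv, rfl, h02⟩ := h
    have hs := congrArg (Int.cast : ℤ → K)
      (D.conjSign_mul_edgeWeight hv (κ (D.edge c 0)))
    rw [D.evalAt_conjugation K (D.isCompatible_of_update hv hκ h02)]
    push_cast at hs ⊢
    linear_combination (D.edgeSign v c : K) * D.evalAt K v (fun e => 1 - κ e) f * hs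
  · simp

variable {D}

/-- The Seifert colours differ at every crossing, so no cube edge acts on this idempotent. For the
same reason none reaches it, which is the next lemma. -/
theorem differential_seifertCochain {κ : Fin D.m → Fin 2} (hκ : D.IsSeifertColouring κ) :
    D.differential K (D.seifertCochain K κ) = 0 := by
  classical
  refine D.eq_zero_of_evalAt_eq_zero fun w κ' hκ' => ?_
  rw [D.evalAt_differential K hκ']
  refine Finset.sum_eq_zero fun c _ => Finset.sum_eq_zero fun v _ => ?_
  split_ifs with h
  · obtain ⟨hv, rfl, h02⟩ := h
    rw [D.evalAt_seifertCochain K hκ.isCompatible (D.isCompatible_of_update hv hκ' h02), if_neg,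
      mul_zero]
    rintro ⟨-, rfl⟩
    exact hκ.ne c h02
  · rfl

theorem evalAt_seifertVertex_differential {κ : Fin D.m → Fin 2} (hκ : D.IsSeifertColouring κ)
    (f : D.Cochains K) : D.evalAt K D.seifertVertex κ (D.differential K f) = 0 := by
  classical
  rw [D.evalAt_differential K hκ.isCompatible]
  exact Finset.sum_eq_zero fun c _ => Finset.sum_eq_zero fun v _ =>
    if_neg fun h => hκ.ne c h.2.2

variable {K}

theorem odd_qDegree (σ : D.Generator) : Odd (D.qDegree σ) := by
  obtain ⟨j, hj⟩ := D.odd_card_circle_add_height_add_nPlus σ.1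
  rw [PDCode.qDegree_eq, hj]
  refine ⟨j - ((∑ C, (σ.2 C : ℕ) : ℕ) : ℤ) - D.nMinus, ?_⟩
  push_cast
  ring

/-- The sign of the leading term depends only on the quantum degree, so one scalar cancels all terms
of lowest degree at once. -/
theorem conjSign_mul_neg_one_pow (σ : D.Generator) :
    D.conjSign σ.1 * (-1) ^ (∑ C, (σ.2 C : ℕ))
      = (Int.negOnePow ((D.qDegree σ - 1) / 2 + D.nMinus) : ℤ) := by
  obtain ⟨j, hj⟩ := D.odd_card_circle_add_height_add_nPlus σ.1
  rw [PDCode.qDegree_eq, PDCode.conjSign, hj]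
  set S := ∑ C, (σ.2 C : ℕ)
  rw [show (((2 * j + 1 : ℕ) : ℤ) - 2 * (S : ℤ) - 2 * D.nMinus - 1) / 2 + D.nMinus = (j : ℤ) - S by
    omega, show (2 * j + 1) / 2 = j by omega, Int.negOnePow_sub]
  simp [Int.negOnePow_def]

/-- A reduced cochain minus the conjugate, with the correct sign, has greater quantum degree. -/
theorem sub_conjugation_mem {b : Fin D.m} {q i : ℤ} (hq : Even q) {f : D.Cochains K}
    (hf : f ∈ D.reducedFiltration K b q i) :
    ∃ a : K, f - a • D.conjugation K f ∈ D.bnFiltration K (q + 1) i := by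
  obtain ⟨g, hg, rfl⟩ := hf
  set f := D.xAction K b g
  have hf : ∀ σ, D.homDegree σ ≠ i ∨ D.qDegree σ < q - 1 → f σ = 0 := by
    intro σ hσ
    by_contra hne
    obtain ⟨τ, hτ, hh, hqd⟩ := D.exists_of_xAction_ne_zero hne
    refine hτ (hg τ fun h => ?_)
    rcases hσ with hσ | hσ
    · exact hσ (hh.trans h.1)
    · have := h.2
      omega
  -- The leading sign in degree `q - 1`, the lowest degree in which `f` can be nonzero.
  refine ⟨((Int.negOnePow ((q - 1 - 1) / 2 + D.nMinus) : ℤ) : K), fun σ hσ => ?_⟩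
  simp only [Pi.sub_apply, Pi.smul_apply, smul_eq_mul]
  by_cases hi : D.homDegree σ = i
  · have hlt : ¬ q + 1 ≤ D.qDegree σ := fun h => hσ ⟨hi, h⟩
    -- Quantum degrees are odd and `q` is even, so degree `q` does not occur.
    have hle : D.qDegree σ ≤ q - 1 := by
      obtain ⟨j, hj⟩ := odd_qDegree σ
      obtain ⟨k, hk⟩ := hq
      omega
    rw [D.conjugation_apply_of_forall_lt K fun τ hτ => hf τ (Or.inr (by omega)),
      conjSign_mul_neg_one_pow]
    rcases hle.lt_or_eq with h | h
    · simp [hf σ (Or.inr h)]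
    · rw [h, ← mul_assoc, ← Int.cast_mul, ← Units.val_mul, ← Int.negOnePow_add,
        Int.negOnePow_even _ (Even.add_self _)]
      simp
  · rw [hf σ (Or.inl hi), PDCode.conjugation_apply]
    have : ∀ l : D.Circle σ.1 → Fin 2, f ⟨σ.1, l⟩ = 0 := fun l => hf ⟨σ.1, l⟩ (Or.inl hi)
    simp [this]

end KnotDiagram

/-! ## Filtrations -/

/-- Beyond an upper bound of the jumps, each step that is `⊤` forces the next higher one to be `⊤`,
starting from indices below `-N`. Monotonicity of `H` is not needed. -/
theorem exists_jump_of_filtration {α : Type*} [PartialOrder α] [BoundedOrder α] [Nontrivial α]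
    {H : ℤ → α} {N : ℤ} (hbot : ∀ q, N < q → H q = ⊥) (htop : ∀ q ≤ -N, H q = ⊤) (s : ℤ) :
    {l | ¬ H (s - 2 * l) ≤ H (s - 2 * l + 2)}.Nonempty ∧
    BddAbove {l | ¬ H (s - 2 * l) ≤ H (s - 2 * l + 2)} ∧
    ∀ g ∈ upperBounds {l | ¬ H (s - 2 * l) ≤ H (s - 2 * l + 2)}, H (s - 2 * g) = ⊤ := by
  have h3 : ∀ g ∈ upperBounds {l | ¬ H (s - 2 * l) ≤ H (s - 2 * l + 2)},
      H (s - 2 * g) = ⊤ := by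
    intro g hg
    have hstep : ∀ k : ℕ, H (s - 2 * (g + k)) = ⊤ → H (s - 2 * g) = ⊤ := by
      intro k
      induction k with
      | zero => simp
      | succ k ih =>
        intro hk
        apply ih
        by_contra hne
        have hmem : g + (k + 1 : ℕ) ∈ {l | ¬ H (s - 2 * l) ≤ H (s - 2 * l + 2)} := by
          intro hle
          rw [hk, top_le_iff] at hle
          refine hne ?_
          rw [← hle]
          congr 1
          push_cast
          ring
        have := hg hmem
        push_cast at this
        omega
    apply hstep (s - 2 * g + N).toNat
    apply htop
    have := Int.self_le_toNat (s - 2 * g + N)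
    have h0 : (0 : ℤ) ≤ (s - 2 * g + N).toNat := Int.natCast_nonneg _
    linarith
  refine ⟨?_, ⟨|s + N| + 2, fun l hl => ?_⟩, h3⟩
  · by_contra hne
    rw [Set.not_nonempty_iff_eq_empty] at hne
    rw [hne] at h3
    -- Without jumps every integer is an upper bound; this one gives an index above `N`, where `H`
    -- is `⊥`.
    have h4 := h3 (-(|s - N| + 1)) (by simp)
    rw [hbot _ (by have := neg_abs_le (s - N); have := abs_nonneg (s - N); linarith)] at h4
    exact bot_ne_top h4
  · by_contra! hlt
    have := le_abs_self (s + N)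
    have := abs_nonneg (s + N)
    refine hl ?_
    rw [htop (s - 2 * l + 2) (by linarith)]
    exact le_top

namespace FilteredCohomology

variable {R M : Type*} [CommRing R] [AddCommGroup M] [Module R M] {d : M →ₗ[R] M}
  {C : ℤ → Submodule R M} {F : ℤ → ℤ → Submodule R M} {hF : ∀ q i, F q i ≤ C i} {i q : ℤ}

theorem mk_mem_inducedFiltration_iff {z : cocycles d C i} :
    (Submodule.Quotient.mk z : Cohomology d C i) ∈ inducedFiltration d C F hF i q ↔
      ∃ z' ∈ F q i, d z' = 0 ∧ (z : M) - z' ∈ (C (i - 1)).map d := by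
  constructor
  · rintro ⟨y, hy⟩
    obtain ⟨z', rfl⟩ := Submodule.Quotient.mk_surjective _ y
    have h := (Submodule.Quotient.eq _).1 (hy.symm.trans (Submodule.mapQ_apply _ _ _ z'))
    exact ⟨z', z'.2.1, z'.2.2, h⟩
  · rintro ⟨z', hz', hd, h⟩
    refine ⟨Submodule.Quotient.mk ⟨z', hz', hd⟩, ?_⟩
    symm
    exact (Submodule.Quotient.eq _).2 h

theorem inducedFiltration_ne_bot {z : M} (hz : z ∈ F q i) (hd : d z = 0)
    (hne : ∀ y, d y ≠ z) : inducedFiltration d C F hF i q ≠ ⊥ := by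
  intro h
  have h1 : (Submodule.Quotient.mk ⟨z, hF q i hz, hd⟩ : Cohomology d C i)
      ∈ inducedFiltration d C F hF i q :=
    mk_mem_inducedFiltration_iff.2 ⟨z, hz, hd, by simp⟩
  rw [h, Submodule.mem_bot, Submodule.Quotient.mk_eq_zero] at h1
  obtain ⟨y, -, hy⟩ := h1
  exact hne y hy

theorem inducedFiltration_eq_bot (h : F q i = ⊥) : inducedFiltration d C F hF i q = ⊥ := by
  rw [eq_bot_iff]
  intro x hx
  obtain ⟨z, rfl⟩ := Submodule.Quotient.mk_surjective _ x
  obtain ⟨z', hz', -, h1⟩ := mk_mem_inducedFiltration_iff.1 hx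
  rw [h, Submodule.mem_bot] at hz'
  rw [Submodule.mem_bot, Submodule.Quotient.mk_eq_zero]
  rwa [hz', sub_zero] at h1

theorem inducedFiltration_eq_top (h : C i ≤ F q i) : inducedFiltration d C F hF i q = ⊤ := by
  rw [eq_top_iff]
  intro x _
  obtain ⟨z, rfl⟩ := Submodule.Quotient.mk_surjective _ x
  exact mk_mem_inducedFiltration_iff.2 ⟨z, h z.2.1, z.2.2, by simp⟩

theorem nontrivial_associatedGraded_iff : Nontrivial (AssociatedGraded d C F hF i q) ↔
    ¬ inducedFiltration d C F hF i q ≤ inducedFiltration d C F hF i (q + 2) := by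
  rw [Submodule.Quotient.nontrivial_iff, ne_eq]
  exact not_congr Submodule.comap_subtype_eq_top

end FilteredCohomology

namespace PDCode

variable (D : PDCode) (K : Type*) [CommRing K]

theorem exists_abs_qDegree_le : ∃ N : ℤ, ∀ σ : D.Generator, |D.qDegree σ| ≤ N := by
  obtain ⟨N, hN⟩ := (Set.finite_range fun σ : D.Generator => |D.qDegree σ|).bddAbove
  exact ⟨N, fun σ => hN ⟨σ, rfl⟩⟩

theorem bnFiltration_eq_bot {N q : ℤ} (hN : ∀ σ : D.Generator, |D.qDegree σ| ≤ N) (hq : N < q)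
    (i : ℤ) : D.bnFiltration K q i = ⊥ := by
  rw [eq_bot_iff]
  intro f hf
  rw [Submodule.mem_bot]
  ext σ
  refine hf σ fun h => ?_
  have := (abs_le.1 (hN σ)).2
  linarith [h.2]

theorem bnComplex_le_bnFiltration {N q : ℤ} (hN : ∀ σ : D.Generator, |D.qDegree σ| ≤ N)
    (hq : q ≤ -N) (i : ℤ) : D.bnComplex K i ≤ D.bnFiltration K q i := by
  intro f hf σ hσ
  refine hf σ fun h => hσ ⟨h, ?_⟩
  have := (abs_le.1 (hN σ)).1
  linarith

theorem seifertCochain_mem (κ : Fin D.m → Fin 2)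
    (h : D.height D.seifertVertex = D.nMinus) :
    D.seifertCochain K κ ∈ D.bnComplex K 0 := by
  intro σ hσ
  refine if_neg fun h' => hσ ?_
  simp only [homDegree, h', h, sub_self]

theorem intCast_mem_bnFiltration {f : D.Cochains ℤ} {q i : ℤ} (hf : f ∈ D.bnFiltration ℤ q i) :
    (fun σ => (f σ : K)) ∈ D.bnFiltration K q i := fun σ hσ =>
  (congrArg _ (hf σ hσ)).trans Int.cast_zero

theorem intCast_mem_reducedFiltration {b : Fin D.m} {f : D.Cochains ℤ} {q i : ℤ}
    (hf : f ∈ D.reducedFiltration ℤ b q i) :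
    (fun σ => (f σ : K)) ∈ D.reducedFiltration K b q i := by
  obtain ⟨g, hg, rfl⟩ := hf
  exact ⟨_, D.intCast_mem_bnFiltration K hg, D.xAction_intCast K b g⟩

end PDCode

/-! ### Existence of the maxima and the comparison of invariants -/

namespace KnotDiagram

variable (D : KnotDiagram)

theorem seifertCochain_ne_differential (K : Type*) [CommRing K] [Nontrivial K]
    {κ : Fin D.m → Fin 2} (hκ : D.IsSeifertColouring κ) (y : D.Cochains K) :
    D.differential K y ≠ D.seifertCochain K κ := by
  intro h
  have h1 := evalAt_seifertVertex_differential K hκ y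
  rw [h, D.evalAt_seifertCochain K hκ.isCompatible hκ.isCompatible] at h1
  simp at h1

/-- `sSup` on `ℤ` has a meaningless default value, so both conditions are checked: there are
finitely many degrees, and the Seifert class is nonzero over any nontrivial ring. -/
theorem isGreatest_sMax (K : Type*) [CommRing K] [Nontrivial K] :
    IsGreatest (D.sMaxSet K) (D.sMax K) := by
  obtain ⟨N, hN⟩ := D.exists_abs_qDegree_le
  have hb : BddAbove (D.sMaxSet K) := by
    refine ⟨N, fun q hq => ?_⟩
    by_contra! h
    exact hq.2 (FilteredCohomology.inducedFiltration_eq_bot (D.bnFiltration_eq_bot K hN h 0))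
  have hne : (D.sMaxSet K).Nonempty := by
    obtain ⟨κ, hκ, -⟩ := D.exists_isSeifertColouring ⟨0, D.m_pos⟩
    -- An odd index at most `-N`, where the filtration is the whole complex.
    refine ⟨-(2 * |N| + 1), (odd_two_mul_add_one _).neg,
      FilteredCohomology.inducedFiltration_ne_bot (z := D.seifertCochain K κ) ?_
        (differential_seifertCochain K hκ) (D.seifertCochain_ne_differential K hκ)⟩
    refine D.bnComplex_le_bnFiltration K hN ?_ 0
      (D.seifertCochain_mem K κ D.height_seifertVertex)
    have := le_abs_self N
    have := abs_nonneg N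
    linarith
  exact ⟨Int.csSup_mem hne hb, fun q hq => le_csSup hb hq⟩

/-- If all of the reduced integral cohomology in degree `0` lies in filtration index `q`, then the
unreduced cohomology over any ring does not vanish in filtration index `q + 1`. -/
theorem add_one_mem_sMaxSet (K : Type*) [CommRing K] [Nontrivial K] (b : Fin D.m) {q : ℤ}
    (hq : Even q) (h : FilteredCohomology.inducedFiltration (D.differential ℤ)
      (D.reducedComplex ℤ b) (D.reducedFiltration ℤ b) (D.reducedFiltration_le ℤ b) 0 q = ⊤) :
    q + 1 ∈ D.sMaxSet K := by
  classical
  obtain ⟨κ, hκ, hκb⟩ := D.exists_isSeifertColouring b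
  have hmem : D.seifertCochain ℤ κ
      ∈ FilteredCohomology.cocycles (D.differential ℤ) (D.reducedComplex ℤ b) 0 :=
    ⟨⟨_, D.seifertCochain_mem ℤ κ D.height_seifertVertex, D.xAction_seifertCochain ℤ hκ hκb⟩,
      differential_seifertCochain ℤ hκ⟩
  obtain ⟨z, hz, hdz, y, -, hy⟩ := FilteredCohomology.mk_mem_inducedFiltration_iff.1
    (h ▸ Submodule.mem_top : Submodule.Quotient.mk ⟨_, hmem⟩ ∈ _)
  -- The coordinate at `κ` depends only on the cohomology class, so `z` inherits the value `1`,
  -- which survives in every `K`.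
  have hz1 : D.evalAt ℤ D.seifertVertex κ z = 1 := by
    have h1 := evalAt_seifertVertex_differential ℤ hκ y
    rw [hy, map_sub, D.evalAt_seifertCochain ℤ hκ.isCompatible hκ.isCompatible,
      if_pos ⟨rfl, rfl⟩, sub_eq_zero] at h1
    exact h1.symm
  set f : D.Cochains K := fun σ => (z σ : K) with hf
  have hf1 : D.evalAt K D.seifertVertex κ f = 1 := by
    rw [hf, D.evalAt_intCast, hz1, Int.cast_one]
  have hdf : D.differential K f = 0 := by
    rw [hf, D.differential_intCast, hdz]
    ext σ
    exact Int.cast_zero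
  have hfmem : f ∈ D.reducedFiltration K b q 0 := D.intCast_mem_reducedFiltration K hz
  -- The colouring `1 - κ` is `0` at `b`, where `f` is a multiple of `x`.
  have hconj : D.evalAt K D.seifertVertex κ (D.conjugation K f) = 0 := by
    obtain ⟨g, -, hg⟩ := hfmem
    rw [D.evalAt_conjugation K hκ.isCompatible, ← hg,
      D.evalAt_xAction K (D.isCompatible_sub hκ.isCompatible), hκb, if_neg (by simp), mul_zero]
  obtain ⟨a, ha⟩ := sub_conjugation_mem hq hfmem
  refine ⟨hq.add_one, FilteredCohomology.inducedFiltration_ne_bot ha ?_ fun y hy => ?_⟩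
  · rw [map_sub, map_smul, D.differential_conjugation, hdf, map_zero, smul_zero, sub_zero]
  · have h1 := evalAt_seifertVertex_differential K hκ y
    rw [hy, map_sub, map_smul, hconj, hf1, smul_zero, sub_zero] at h1
    exact one_ne_zero h1

theorem gradedLength_spec (b : Fin D.m) :
    IsGreatest (D.gradedLengthSet b) (D.gradedLength b) ∧
    FilteredCohomology.inducedFiltration (D.differential ℤ) (D.reducedComplex ℤ b)
      (D.reducedFiltration ℤ b) (D.reducedFiltration_le ℤ b) 0
      (D.sInvariant ℚ - 2 * D.gradedLength b) = ⊤ := by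
  obtain ⟨N, hN⟩ := D.exists_abs_qDegree_le
  obtain ⟨κ, hκ, hκb⟩ := D.exists_isSeifertColouring b
  have hmem : D.seifertCochain ℤ κ ∈ D.reducedComplex ℤ b 0 :=
    ⟨_, D.seifertCochain_mem ℤ κ D.height_seifertVertex, D.xAction_seifertCochain ℤ hκ hκb⟩
  -- The extra `1` absorbs the shift from index `q` to `F_{q+1}`.
  have htop : ∀ q ≤ -(N + 1), D.reducedComplex ℤ b 0 ≤ D.reducedFiltration ℤ b q 0 :=
    fun q hq => Submodule.map_mono (D.bnComplex_le_bnFiltration ℤ hN (by linarith) 0)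
  have hbot : ∀ q, N + 1 < q → D.reducedFiltration ℤ b q 0 = ⊥ := fun q hq => by
    rw [PDCode.reducedFiltration, D.bnFiltration_eq_bot ℤ hN (by linarith) 0, Submodule.map_bot]
  have hnt : Nontrivial (Submodule ℤ (FilteredCohomology.Cohomology (D.differential ℤ)
      (D.reducedComplex ℤ b) 0)) :=
    ⟨_, _, FilteredCohomology.inducedFiltration_ne_bot (hF := D.reducedFiltration_le ℤ b)
      (htop (-(N + 1)) le_rfl hmem) (differential_seifertCochain ℤ hκ)
      (D.seifertCochain_ne_differential ℤ hκ)⟩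
  obtain ⟨h1, h2, h3⟩ := exists_jump_of_filtration
    (H := fun q => FilteredCohomology.inducedFiltration (D.differential ℤ) (D.reducedComplex ℤ b)
      (D.reducedFiltration ℤ b) (D.reducedFiltration_le ℤ b) 0 q) (N := N + 1)
    (fun q hq => FilteredCohomology.inducedFiltration_eq_bot (hbot q hq))
    (fun q hq => FilteredCohomology.inducedFiltration_eq_top (htop q hq)) (D.sInvariant ℚ)
  have hset : D.gradedLengthSet b = _ :=
    Set.ext fun l => FilteredCohomology.nontrivial_associatedGraded_iff
  rw [← hset] at h1 h2 h3
  have hg : IsGreatest (D.gradedLengthSet b) (D.gradedLength b) :=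
    ⟨Int.csSup_mem h1 h2, fun l hl => le_csSup h2 hl⟩
  exact ⟨hg, h3 _ hg.2⟩

end KnotDiagram

end

theorem mainTheorem6 (D : KnotDiagram) (b : Fin D.m) (p : ℕ) [Fact p.Prime] :
    IsGreatest (D.sMaxSet ℚ) (D.sMax ℚ) ∧
    IsGreatest (D.sMaxSet (ZMod p)) (D.sMax (ZMod p)) ∧
    IsGreatest (D.gradedLengthSet b) (D.gradedLength b) ∧
    ((D.sInvariant ℚ : ℚ) - (D.sInvariant (ZMod p) : ℚ)) / 2 ≤ (D.gradedLength b : ℚ) := by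
  have hQ := D.isGreatest_sMax ℚ
  have hp := D.isGreatest_sMax (ZMod p)
  obtain ⟨hg, htop⟩ := D.gradedLength_spec b
  refine ⟨hQ, hp, hg, ?_⟩
  -- `sMax` is odd, so `s^ℚ` is even, as cancelling the lowest degree requires.
  have heven : Even (D.sInvariant ℚ - 2 * D.gradedLength b) :=
    (hQ.1.1.sub_odd odd_one).sub (even_two_mul _)
  have hle := hp.2 (D.add_one_mem_sMaxSet (ZMod p) b heven htop)
  have hle' : D.sInvariant ℚ - 2 * D.gradedLength b ≤ D.sInvariant (ZMod p) := by
    exact le_sub_iff_add_le.2 hle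
  have hle'' : (D.sInvariant ℚ : ℚ) - 2 * D.gradedLength b ≤ D.sInvariant (ZMod p) := by
    exact_mod_cast hle'
  linarith
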